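/- **Theorem (lower bound for weakly log-concave samplers).** For a potential $f:\mathbb R^d\to\mathbb R$ with $\int e^{-f}<\infty$ let $\pi_f$ be the probability distribution with density proportional to $e^{-f}$. Call $f$ *$1$-smooth* if it is twice differentiable with $\nabla^2 f\preceq I$. A probability distribution $\rho_0$ is an *$M$-infinite Rényi warm start* for $\pi$ if $\mathcal R_\infty(\rho_0\|\pi)=\ln\big\|\tfrac{d\rho_0}{d\pi}\big\|_{L^\infty(\pi)}\le M$ (with value $+\infty$ unless $\rho_0\ll\pi$). A *randomized adaptive algorithm* $\mathsf A$ with $k$ queries per round receives a random initial point $x^0\sim\rho_0$, with the value $f(x^0)$, and a number of rounds $r$. In each round $i=1,\dots,r$ it chooses a batch of at most $k$ points as a measurable function of a fresh random variable, uniform on $[0,1]$, and of all previous points and answers, and it receives the values of $f$ at these points. After round $r$ it returns a point $x^{r+1}$, again a measurable function of a fresh uniform random variable and of all points and answers so far. Let $\mathsf T(\mathsf A,f,x^0,\varepsilon)\in\{0,1,2,\dots\}\cup\{\infty\}$ be the least $r$ for which the law $\rho$ of the returned point satisfies $\mathsf{TV}(\rho,\pi_f)=\sup_A|\rho(A)-\pi_f(A)|\le\varepsilon$.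 For a class $\mathcal F$ of potentials on $\mathbb R^d$ put $$\mathsf{Comp}^{k}_{\mathsf R}(\mathcal F,\varepsilon,x^0)=\inf_{\mathsf A}\ \sup_{f\in\mathcal F}\ \mathsf T(\mathsf A,f,x^0,\varepsilon),$$ the infimum being over all randomized adaptive algorithms with $k$ queries per round. Let the regularity condition be either "$1$-smooth" or "$1$-Lipschitz". For a probability distribution $\rho_0$ on $\mathbb R^d$ and $M\in\mathbb R$, let $\mathcal F_d(\rho_0,M)$ be the class of all convex potentials $f$ on $\mathbb R^d$ (no strong convexity) that satisfy the regularity condition, for which $\int e^{-f}<\infty$, and for which $\rho_0$ is an $M$-infinite Rényi warm start for $\pi_f$. Then, for each of the two conditions, there are constants $c\in(0,1)$, $C\in\mathbb R$ and $m\in\mathbb N$ such that for all $\alpha=\alpha(d)\to\infty$ and all $\varepsilon=\varepsilon(d)=O(c^d)$ there are $\gamma=\gamma(d)=O(d^{-\alpha(d)})$ and probability distributions $\rho_0=\rho_{0,d}$ on $\mathbb R^d$ with the following property. Let $M_d=C\,d\,(\log d)^m=\widetilde O(d)$. For every polynomial $q$ with natural number coefficients, and all $d$ sufficiently large (depending on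 $q,\alpha,\varepsilon$), $$\mathsf{Comp}^{q(d)}_{\mathsf R}\big(\mathcal F_d(\rho_0,M_d),\varepsilon,x^0\big)\ \ge\ (1-\gamma)\,\frac{d}{\alpha\log^3 d},\qquad x^0\sim\rho_0 .$$ -/

import Mathlib

open MeasureTheory Filter Asymptotics
open scoped ENNReal

/-- Euclidean space of dimension `d`. -/
abbrev Eucl (d : ℕ) : Type := EuclideanSpace ℝ (Fin d)

noncomputable section

/-- The distribution `π_f` with Lebesgue density `exp (-f) / ∫ exp (-f)`. -/
def gibbs {d : ℕ} (f : Eucl d → ℝ) : Measure (Eucl d) :=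
  (volume : Measure (Eucl d)).tilted (fun x => -f x)

/-- Total variation distance: the supremum over measurable sets `A` of `|μ A - ν A|`. -/
def tvDist {X : Type*} [MeasurableSpace X] (μ ν : Measure X) : ℝ :=
  ⨆ A : {A : Set X // MeasurableSet A}, |μ.real A.1 - ν.real A.1|

open scoped Classical in
/-- Infinite Rényi divergence `log ‖dμ/dν‖_{L^∞(ν)}`, equal to `+∞` unless `μ ≪ ν`. -/
def renyiInf {X : Type*} [MeasurableSpace X] (μ ν : Measure X) : EReal :=
  if μ ≪ ν then ENNReal.log (essSup (μ.rnDeriv ν) ν) else ⊤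

/-- The two regularity conditions on a convex potential. -/
inductive Regularity
  | smooth
  | lipschitz

/-- `f` is twice differentiable with Hessian at most `L • I` in the Loewner order. -/
def IsSmoothPotential {d : ℕ} (L : ℝ) (f : Eucl d → ℝ) : Prop :=
  Differentiable ℝ f ∧ Differentiable ℝ (fderiv ℝ f) ∧
    ∀ x v : Eucl d, fderiv ℝ (fderiv ℝ f) x v v ≤ L * ‖v‖ ^ 2

/-- Convex potentials on `ℝ^d` that are `1`-smooth, respectively `1`-Lipschitz. -/
def convexPotentials (reg : Regularity) (d : ℕ) : Set (Eucl d → ℝ) :=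
  {f | ConvexOn ℝ Set.univ f ∧
    match reg with
    | .smooth => IsSmoothPotential 1 f
    | .lipschitz => LipschitzWith 1 f}

/-- The potentials of the given regularity for which `π_f` is a probability distribution and `ρ₀`
is an `M`-infinite Rényi warm start for `π_f`. -/
def warmPotentials (reg : Regularity) (d : ℕ) (ρ₀ : Measure (Eucl d)) (M : ℝ) :
    Set (Eucl d → ℝ) :=
  {f | f ∈ convexPotentials reg d ∧ Integrable (fun x => Real.exp (-f x)) ∧
    renyiInf ρ₀ (gibbs f) ≤ (M : EReal)}

/-- What an algorithm has seen after `n` rounds with `k` queries each: the initial point with the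
oracle's answer, and for each round the batch of queries with the oracle's answers. -/
abbrev Transcript (d k n : ℕ) : Type :=
  (Eucl d × ℝ) × (Fin n → Fin k → Eucl d × ℝ)

/-- A randomized adaptive algorithm in dimension `d` with (at most) `k` queries per round.
Given the number `r` of rounds, `next r i` chooses the batch queried in round `i + 1` (`i < r`) and
`output r` chooses the returned point, each from fresh random bits (a uniform element of `[0, 1]`)
and the transcript so far. Smaller batches are covered by repeating a query. -/
structure AdaptiveAlgorithm (d k : ℕ) where
  next : (r i : ℕ) → unitInterval × Transcript d k i → (Fin k → Eucl d)
  output : (r : ℕ) → unitInterval × Transcript d k r → Eucl d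
  measurable_next : ∀ r i, Measurable (next r i)
  measurable_output : ∀ r, Measurable (output r)

namespace AdaptiveAlgorithm

variable {d k : ℕ}

/-- The transcript after `n` rounds of the run with `r` rounds in total, for the zeroth-order oracle
of `f`, the initial point `x₀` and the random bits `ξ`. -/
def transcript (A : AdaptiveAlgorithm d k) (f : Eucl d → ℝ) (r : ℕ) (x₀ : Eucl d)
    (ξ : ℕ → unitInterval) : (n : ℕ) → Transcript d k n
  | 0 => ((x₀, f x₀), Fin.elim0)
  | n + 1 =>
    let h := A.transcript f r x₀ ξ n
    let Q := A.next r n (ξ n, h)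
    (h.1, Fin.snoc (α := fun _ => Fin k → Eucl d × ℝ) h.2 (fun j => (Q j, f (Q j))))

/-- The point returned after `r` rounds. -/
def run (A : AdaptiveAlgorithm d k) (f : Eucl d → ℝ) (r : ℕ) (x₀ : Eucl d)
    (ξ : ℕ → unitInterval) : Eucl d :=
  A.output r (ξ r, A.transcript f r x₀ ξ r)

/-- The marginal law of the point returned after `r` rounds, for an initial point distributed
according to `ρ₀` and independent, independently and uniformly distributed random bits. -/
def outputLaw (A : AdaptiveAlgorithm d k) (f : Eucl d → ℝ) (ρ₀ : Measure (Eucl d)) (r : ℕ) :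
    Measure (Eucl d) :=
  (ρ₀.prod (Measure.infinitePi fun _ : ℕ => (volume : Measure unitInterval))).map
    fun ω => A.run f r ω.1 ω.2

/-- The least number of rounds after which the output is `ε`-accurate in total variation
(`⊤` if there is none). -/
def rounds (A : AdaptiveAlgorithm d k) (f : Eucl d → ℝ) (ρ₀ : Measure (Eucl d)) (ε : ℝ) : ℕ∞ :=
  ⨅ r ∈ {r : ℕ | tvDist (A.outputLaw f ρ₀ r) (gibbs f) ≤ ε}, (r : ℕ∞)

end AdaptiveAlgorithm

/-- Randomized adaptive complexity of the class `F` with `k` queries per round. -/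
def randomizedComplexity {d : ℕ} (k : ℕ) (F : Set (Eucl d → ℝ)) (ε : ℝ) (ρ₀ : Measure (Eucl d)) :
    ℕ∞ :=
  ⨅ A : AdaptiveAlgorithm d k, ⨆ f ∈ F, A.rounds f ρ₀ ε

end

/-!
The hard potentials live in a coordinate plane. A digit sequence `w` in base `B` is a slope in
`[0, 1]`, revealed one digit at a time: the `j`-th wedge penalizes the distance from the line whose
slope is made of the first `j` digits, and the potential is a soft maximum of the wedges. Outside
the `j`-th cone, of aperture of order `B ^ (-j)`, the `j`-th wedge dominates all later ones, so a
query there reveals only the first `j` digits. Hitting the next cone amounts to guessing the next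
digit, which a batch of polynomial size does with probability at most `poly(d) / B`; on average
over `w`, an algorithm therefore learns one digit per round. On the other hand the Gibbs measure is
concentrated on the innermost cone, which depends on all `d` digits.
-/

noncomputable section

/-! ### A twice differentiable maximum -/

theorem hasDerivAt_max_zero_pow (n : ℕ) (t : ℝ) :
    HasDerivAt (fun t : ℝ => max t 0 ^ (n + 2)) ((n + 2 : ℕ) * max t 0 ^ (n + 1)) t := by
  refine hasDerivAt_of_hasDerivAt_of_ne' (x := 0)
    (g := fun t : ℝ => ((n + 2 : ℕ) : ℝ) * max t 0 ^ (n + 1)) (fun y hy => ?_)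
    (by fun_prop) (by fun_prop) t
  rcases hy.lt_or_gt with hneg | hpos
  · have hzero : (fun t : ℝ => max t 0 ^ (n + 2)) =ᶠ[nhds y] fun _ => 0 := by
      filter_upwards [Iio_mem_nhds hneg] with t ht
      rw [max_eq_right (Set.mem_Iio.1 ht).le, zero_pow (by omega)]
    simpa [max_eq_right hneg.le] using (hasDerivAt_const y (0 : ℝ)).congr_of_eventuallyEq hzero
  · have hpow : (fun t : ℝ => max t 0 ^ (n + 2)) =ᶠ[nhds y] fun t => t ^ (n + 2) := by
      filter_upwards [Ioi_mem_nhds hpos] with t ht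
      rw [max_eq_left (Set.mem_Ioi.1 ht).le]
    simpa [max_eq_left hpos.le] using (hasDerivAt_pow (n + 2) y).congr_of_eventuallyEq hpow

/-- A twice differentiable convex modification of the positive part, equal to it outside
`[-1, 1]`. Its second derivative is the piecewise linear hat function on `[-1, 1]`. -/
def softPos (t : ℝ) : ℝ := (max (t + 1) 0 ^ 3 - 2 * max t 0 ^ 3 + max (t - 1) 0 ^ 3) / 6

/-- The derivative of `softPos`. -/
def softPosDeriv (t : ℝ) : ℝ := (max (t + 1) 0 ^ 2 - 2 * max t 0 ^ 2 + max (t - 1) 0 ^ 2) / 2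

/-- The second derivative of `softPos`. -/
def softPosDeriv₂ (t : ℝ) : ℝ := max (t + 1) 0 - 2 * max t 0 + max (t - 1) 0

theorem hasDerivAt_softPos (t : ℝ) : HasDerivAt softPos (softPosDeriv t) t := by
  have hleft := (hasDerivAt_max_zero_pow 1 (t + 1)).comp_add_const t 1
  have hmid := (hasDerivAt_max_zero_pow 1 t).const_mul 2
  have hright := (hasDerivAt_max_zero_pow 1 (t - 1)).comp_sub_const t 1
  refine (((hleft.sub hmid).add hright).div_const 6).congr_deriv ?_
  simp only [softPosDeriv]
  push_cast
  ring

theorem hasDerivAt_softPosDeriv (t : ℝ) : HasDerivAt softPosDeriv (softPosDeriv₂ t) t := by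
  have hleft := (hasDerivAt_max_zero_pow 0 (t + 1)).comp_add_const t 1
  have hmid := (hasDerivAt_max_zero_pow 0 t).const_mul 2
  have hright := (hasDerivAt_max_zero_pow 0 (t - 1)).comp_sub_const t 1
  refine (((hleft.sub hmid).add hright).div_const 2).congr_deriv ?_
  simp only [softPosDeriv₂]
  push_cast
  ring

theorem softPosDeriv₂_mem_Icc (t : ℝ) : softPosDeriv₂ t ∈ Set.Icc 0 1 := by
  unfold softPosDeriv₂
  constructor <;> rcases max_cases (t + 1) 0 with h | h <;> rcases max_cases t 0 with h' | h' <;>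
    rcases max_cases (t - 1) 0 with h'' | h'' <;> linarith

theorem softPosDeriv_of_le_neg_one {t : ℝ} (ht : t ≤ -1) : softPosDeriv t = 0 := by
  unfold softPosDeriv
  rw [max_eq_right (by linarith), max_eq_right (by linarith), max_eq_right (by linarith)]
  norm_num

theorem softPosDeriv_of_one_le {t : ℝ} (ht : 1 ≤ t) : softPosDeriv t = 1 := by
  unfold softPosDeriv
  rw [max_eq_left (by linarith), max_eq_left (by linarith), max_eq_left (by linarith)]
  ring

theorem softPos_of_le_neg_one {t : ℝ} (ht : t ≤ -1) : softPos t = 0 := by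
  unfold softPos
  rw [max_eq_right (by linarith), max_eq_right (by linarith), max_eq_right (by linarith)]
  norm_num

theorem softPos_of_one_le {t : ℝ} (ht : 1 ≤ t) : softPos t = t := by
  unfold softPos
  rw [max_eq_left (by linarith), max_eq_left (by linarith), max_eq_left (by linarith)]
  ring

theorem monotone_softPosDeriv : Monotone softPosDeriv :=
  monotone_of_hasDerivAt_nonneg hasDerivAt_softPosDeriv fun t => (softPosDeriv₂_mem_Icc t).1

theorem softPosDeriv_mem_Icc (t : ℝ) : softPosDeriv t ∈ Set.Icc 0 1 :=
  ⟨softPosDeriv_of_le_neg_one (min_le_right t (-1)) ▸ monotone_softPosDeriv (min_le_left t (-1)),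
    softPosDeriv_of_one_le (le_max_right t 1) ▸ monotone_softPosDeriv (le_max_left t 1)⟩

theorem monotone_softPos : Monotone softPos :=
  monotone_of_hasDerivAt_nonneg hasDerivAt_softPos fun t => (softPosDeriv_mem_Icc t).1

theorem monotone_sub_softPos : Monotone fun t => t - softPos t :=
  monotone_of_hasDerivAt_nonneg (fun t => (hasDerivAt_id' t).sub (hasDerivAt_softPos t))
    fun t => sub_nonneg.2 (softPosDeriv_mem_Icc t).2

theorem convexOn_softPos : ConvexOn ℝ Set.univ softPos := by
  refine Monotone.convexOn_univ_of_deriv (fun t => (hasDerivAt_softPos t).differentiableAt) ?_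
  rw [show deriv softPos = softPosDeriv from funext fun t => (hasDerivAt_softPos t).deriv]
  exact monotone_softPosDeriv

theorem softPos_nonneg (t : ℝ) : 0 ≤ softPos t :=
  softPos_of_le_neg_one (min_le_right t (-1)) ▸ monotone_softPos (min_le_left t (-1))

theorem self_le_softPos (t : ℝ) : t ≤ softPos t := by
  have := monotone_sub_softPos (le_max_left t 1)
  simp only [softPos_of_one_le (le_max_right t 1)] at this
  linarith

theorem softPos_le (t : ℝ) : softPos t ≤ max t 0 + 1 / 6 := by
  have hzero : softPos 0 = 1 / 6 := by norm_num [softPos]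
  rcases le_total t 0 with ht | ht
  · rw [max_eq_right ht]
    linarith [monotone_softPos ht]
  · rw [max_eq_left ht]
    have := monotone_sub_softPos ht
    simp only [hzero] at this
    linarith

/-- A twice differentiable convex modification of the maximum of two numbers, equal to it where
they differ by at least `1`. -/
def softMax (a b : ℝ) : ℝ := b + softPos (a - b)

theorem le_softMax_left (a b : ℝ) : a ≤ softMax a b := by
  unfold softMax
  linarith [self_le_softPos (a - b)]

theorem le_softMax_right (a b : ℝ) : b ≤ softMax a b :=
  le_add_of_nonneg_right (softPos_nonneg _)

theorem softMax_le {a b c : ℝ} (ha : a ≤ c) (hb : b ≤ c) : softMax a b ≤ c + 1 / 6 := by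
  have := softPos_le (a - b)
  unfold softMax
  rcases max_cases (a - b) 0 with h | h <;> linarith

theorem softMax_of_add_one_le {a b : ℝ} (h : b + 1 ≤ a) : softMax a b = a := by
  rw [softMax, softPos_of_one_le (by linarith), add_sub_cancel]

theorem softMax_le_softMax {a a' b b' : ℝ} (ha : a ≤ a') (hb : b ≤ b') :
    softMax a b ≤ softMax a' b' := by
  have hleft := monotone_softPos (sub_le_sub_right ha b)
  have hright := monotone_sub_softPos (sub_le_sub_left hb a')
  simp only at hright
  unfold softMax
  linarith

/-- A twice differentiable convex modification of the absolute value. -/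
def softAbs (t : ℝ) : ℝ := softMax t (-t)

theorem abs_le_softAbs (t : ℝ) : |t| ≤ softAbs t :=
  abs_le'.2 ⟨le_softMax_left _ _, le_softMax_right _ _⟩

theorem softAbs_le (t : ℝ) : softAbs t ≤ |t| + 1 / 6 :=
  softMax_le (le_abs_self t) (neg_le_abs t)

theorem convexOn_softMax {E : Type*} [AddCommMonoid E] [Module ℝ E] {s : Set E} {g g' : E → ℝ}
    (hg : ConvexOn ℝ s g) (hg' : ConvexOn ℝ s g') :
    ConvexOn ℝ s fun x => softMax (g x) (g' x) := by
  refine ⟨hg.1, fun x hx y hy a b ha hb hab => ?_⟩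
  calc softMax (g (a • x + b • y)) (g' (a • x + b • y))
      ≤ softMax (a • g x + b • g y) (a • g' x + b • g' y) :=
        softMax_le_softMax (hg.2 hx hy ha hb hab) (hg'.2 hx hy ha hb hab)
    _ = a • g' x + b • g' y + softPos (a • (g x - g' x) + b • (g y - g' y)) := by
        simp only [softMax, smul_eq_mul]
        ring_nf
    _ ≤ a • g' x + b • g' y + (a • softPos (g x - g' x) + b • softPos (g y - g' y)) :=
        add_le_add_right (convexOn_softPos.2 trivial trivial ha hb hab) _
    _ = a • softMax (g x) (g' x) + b • softMax (g y) (g' y) := by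
        simp only [softMax, smul_eq_mul]
        ring

/-! ### Convex functions with bounded gradient and Hessian -/

/-- `g` is convex and twice differentiable, its gradient has norm at most `L` and its Hessian is
at most `H • I`. -/
structure SmoothConvex {V : Type*} [NormedAddCommGroup V] [NormedSpace ℝ V] (L H : ℝ)
    (g : V → ℝ) : Prop where
  convex : ConvexOn ℝ Set.univ g
  diff : Differentiable ℝ g
  diff_fderiv : Differentiable ℝ (fderiv ℝ g)
  norm_fderiv_le : ∀ x, ‖fderiv ℝ g x‖ ≤ L
  hessian_le : ∀ x v, fderiv ℝ (fderiv ℝ g) x v v ≤ H * ‖v‖ ^ 2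

section chainRule

variable {V : Type*} [NormedAddCommGroup V] [NormedSpace ℝ V] {g g' : V → ℝ}

theorem fderiv_softMax (hg : Differentiable ℝ g) (hg' : Differentiable ℝ g') :
    fderiv ℝ (fun x => softMax (g x) (g' x)) = fun x =>
      fderiv ℝ g' x + softPosDeriv (g x - g' x) • (fderiv ℝ g x - fderiv ℝ g' x) := by
  funext x
  have hpos := (hasDerivAt_softPos (g x - g' x)).comp_hasFDerivAt x
    ((hg x).hasFDerivAt.sub (hg' x).hasFDerivAt)
  exact ((hg' x).hasFDerivAt.add hpos).fderiv

theorem hasFDerivAt_fderiv_softMax (hg : Differentiable ℝ g) (hg' : Differentiable ℝ g')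
    (hDg : Differentiable ℝ (fderiv ℝ g)) (hDg' : Differentiable ℝ (fderiv ℝ g')) (x : V) :
    HasFDerivAt (fderiv ℝ fun x => softMax (g x) (g' x))
      (fderiv ℝ (fderiv ℝ g') x +
        (softPosDeriv (g x - g' x) • (fderiv ℝ (fderiv ℝ g) x - fderiv ℝ (fderiv ℝ g') x) +
          (softPosDeriv₂ (g x - g' x) • (fderiv ℝ g x - fderiv ℝ g' x)).smulRight
            (fderiv ℝ g x - fderiv ℝ g' x))) x := by
  rw [fderiv_softMax hg hg']
  have hweight := (hasDerivAt_softPosDeriv (g x - g' x)).comp_hasFDerivAt x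
    ((hg x).hasFDerivAt.sub (hg' x).hasFDerivAt)
  exact (hDg' x).hasFDerivAt.add
    (hweight.fun_smul ((hDg x).hasFDerivAt.sub (hDg' x).hasFDerivAt))

end chainRule

namespace SmoothConvex

variable {V : Type*} [NormedAddCommGroup V] [NormedSpace ℝ V] {L H L' H' : ℝ} {g g' : V → ℝ}

theorem mono (h : SmoothConvex L H g) (hL : L ≤ L') (hH : H ≤ H') : SmoothConvex L' H' g where
  __ := h
  norm_fderiv_le x := (h.norm_fderiv_le x).trans hL
  hessian_le x v := (h.hessian_le x v).trans (by gcongr)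

theorem add (h : SmoothConvex L H g) (h' : SmoothConvex L' H' g') :
    SmoothConvex (L + L') (H + H') (fun x => g x + g' x) := by
  have hD : fderiv ℝ (fun x => g x + g' x) = fun x => fderiv ℝ g x + fderiv ℝ g' x :=
    funext fun x => fderiv_fun_add (h.diff x) (h'.diff x)
  refine ⟨h.convex.add h'.convex, h.diff.add h'.diff, ?_, fun x => ?_, fun x v => ?_⟩ <;> rw [hD]
  · exact h.diff_fderiv.add h'.diff_fderiv
  · exact (norm_add_le _ _).trans (add_le_add (h.norm_fderiv_le x) (h'.norm_fderiv_le x))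
  · rw [fderiv_fun_add (h.diff_fderiv x) (h'.diff_fderiv x), add_mul]
    exact add_le_add (h.hessian_le x v) (h'.hessian_le x v)

theorem const_mul (h : SmoothConvex L H g) {c : ℝ} (hc : 0 ≤ c) :
    SmoothConvex (c * L) (c * H) (fun x => c * g x) := by
  have hD : fderiv ℝ (fun x => c * g x) = fun x => c • fderiv ℝ g x :=
    funext fun x => fderiv_const_mul (h.diff x) c
  refine ⟨h.convex.smul hc, h.diff.const_mul c, ?_, fun x => ?_, fun x v => ?_⟩ <;> rw [hD]
  · exact h.diff_fderiv.const_smul c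
  · rw [norm_smul, Real.norm_of_nonneg hc]
    exact mul_le_mul_of_nonneg_left (h.norm_fderiv_le x) hc
  · rw [fderiv_fun_const_smul (h.diff_fderiv x), mul_assoc]
    exact mul_le_mul_of_nonneg_left (h.hessian_le x v) hc

theorem affine (ℓ : V →L[ℝ] ℝ) (b : ℝ) : SmoothConvex ‖ℓ‖ 0 (fun x => ℓ x + b) := by
  have hD : fderiv ℝ (fun x => ℓ x + b) = fun _ => ℓ := funext fun x => by
    rw [fderiv_add_const]
    exact ℓ.fderiv
  refine ⟨(ℓ.toLinearMap.convexOn convex_univ).add_const b, ℓ.differentiable.add_const b, ?_,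
    fun x => ?_, fun x v => ?_⟩ <;> rw [hD]
  · exact differentiable_const _
  · simp

theorem sum {ι : Type*} (s : Finset ι) {g : ι → V → ℝ} {L H : ι → ℝ}
    (h : ∀ i ∈ s, SmoothConvex (L i) (H i) (g i)) :
    SmoothConvex (∑ i ∈ s, L i) (∑ i ∈ s, H i) (fun x => ∑ i ∈ s, g i x) := by
  classical
  induction s using Finset.induction_on with
  | empty => simpa using affine (0 : V →L[ℝ] ℝ) 0
  | insert i s hi ih =>
    simp only [Finset.sum_insert hi]
    exact (h i (Finset.mem_insert_self i s)).add
      (ih fun j hj => h j (Finset.mem_insert_of_mem hj))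

theorem norm_fderiv_softMax_le (h : SmoothConvex L H g) (h' : SmoothConvex L H' g') (x : V) :
    ‖fderiv ℝ (fun x => softMax (g x) (g' x)) x‖ ≤ L := by
  rw [fderiv_softMax h.diff h'.diff]
  obtain ⟨hp₀, hp₁⟩ := softPosDeriv_mem_Icc (g x - g' x)
  set p := softPosDeriv (g x - g' x)
  calc ‖fderiv ℝ g' x + p • (fderiv ℝ g x - fderiv ℝ g' x)‖
      = ‖(1 - p) • fderiv ℝ g' x + p • fderiv ℝ g x‖ := by
        congr 1
        module
    _ ≤ (1 - p) * ‖fderiv ℝ g' x‖ + p * ‖fderiv ℝ g x‖ := by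
        refine (norm_add_le _ _).trans_eq ?_
        rw [norm_smul, norm_smul, Real.norm_of_nonneg hp₀, Real.norm_of_nonneg (sub_nonneg.2 hp₁)]
    _ ≤ (1 - p) * L + p * L :=
        add_le_add (mul_le_mul_of_nonneg_left (h'.norm_fderiv_le x) (sub_nonneg.2 hp₁))
          (mul_le_mul_of_nonneg_left (h.norm_fderiv_le x) hp₀)
    _ = L := by ring

theorem hessian_softMax_le (h : SmoothConvex L H g) (h' : SmoothConvex L H g') (x v : V) :
    fderiv ℝ (fderiv ℝ fun x => softMax (g x) (g' x)) x v v ≤ (H + (2 * L) ^ 2) * ‖v‖ ^ 2 := by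
  rw [(hasFDerivAt_fderiv_softMax h.diff h'.diff h.diff_fderiv h'.diff_fderiv x).fderiv]
  obtain ⟨hp₀, hp₁⟩ := softPosDeriv_mem_Icc (g x - g' x)
  obtain ⟨-, hq₁⟩ := softPosDeriv₂_mem_Icc (g x - g' x)
  simp only [add_apply, smul_apply, sub_apply, ContinuousLinearMap.smulRight_apply, smul_eq_mul]
  set p := softPosDeriv (g x - g' x)
  set q := softPosDeriv₂ (g x - g' x)
  set D := fderiv ℝ g x - fderiv ℝ g' x with hD
  have hDnorm : ‖D‖ ≤ 2 * L := by
    linarith [norm_sub_le (fderiv ℝ g x) (fderiv ℝ g' x), h.norm_fderiv_le x, h'.norm_fderiv_le x]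
  have hsq : D v ^ 2 ≤ (2 * L) ^ 2 * ‖v‖ ^ 2 := by
    rw [← sq_abs, ← mul_pow]
    exact pow_le_pow_left₀ (abs_nonneg _) (D.le_of_opNorm_le hDnorm v) 2
  have hcurv : q * D v ^ 2 ≤ (2 * L) ^ 2 * ‖v‖ ^ 2 :=
    (mul_le_of_le_one_left (sq_nonneg _) hq₁).trans hsq
  have hg := mul_le_mul_of_nonneg_left (h.hessian_le x v) hp₀
  have hg' := mul_le_mul_of_nonneg_left (h'.hessian_le x v) (sub_nonneg.2 hp₁)
  rw [hD, sub_apply] at hcurv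
  linarith

theorem softMax (h : SmoothConvex L H g) (h' : SmoothConvex L H g') :
    SmoothConvex L (H + (2 * L) ^ 2) (fun x => softMax (g x) (g' x)) where
  convex := convexOn_softMax h.convex h'.convex
  diff x := (h'.diff x).add
    ((hasDerivAt_softPos _).differentiableAt.comp x ((h.diff x).sub (h'.diff x)))
  diff_fderiv x := (hasFDerivAt_fderiv_softMax h.diff h'.diff h.diff_fderiv h'.diff_fderiv
    x).differentiableAt
  norm_fderiv_le := h.norm_fderiv_softMax_le h'
  hessian_le := h.hessian_softMax_le h'

theorem softAbs (ℓ : V →L[ℝ] ℝ) :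
    SmoothConvex ‖ℓ‖ ((2 * ‖ℓ‖) ^ 2) (fun x => softAbs (ℓ x)) := by
  have hneg := affine (-ℓ) 0
  rw [norm_neg] at hneg
  simpa [_root_.softAbs] using (affine ℓ 0).softMax hneg

theorem lipschitzWith {L : NNReal} (h : SmoothConvex L H g) : LipschitzWith L g :=
  lipschitzWith_of_nnnorm_fderiv_le h.diff h.norm_fderiv_le

end SmoothConvex

theorem SmoothConvex.mem_convexPotentials {d : ℕ} {g : Eucl d → ℝ} (h : SmoothConvex 1 1 g)
    (reg : Regularity) : g ∈ convexPotentials reg d := by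
  refine ⟨h.convex, ?_⟩
  cases reg
  · exact ⟨h.diff, h.diff_fderiv, h.hessian_le⟩
  · exact SmoothConvex.lipschitzWith (L := 1) h

/-! ### Slopes and cones -/

section slopes

variable {B : ℕ} {w w' : ℕ → Fin B} {i j : ℕ}

/-- The number in `[0, 1]` whose expansion in base `B` consists of the first `j` digits of `w`. -/
def partialSlope (w : ℕ → Fin B) (j : ℕ) : ℝ := ∑ i ∈ Finset.range j, (w i : ℝ) / B ^ (i + 1)

theorem partialSlope_zero (w : ℕ → Fin B) : partialSlope w 0 = 0 := Finset.sum_range_zero _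

theorem partialSlope_succ (w : ℕ → Fin B) (j : ℕ) :
    partialSlope w (j + 1) = partialSlope w j + w j / B ^ (j + 1) := Finset.sum_range_succ _ _

theorem partialSlope_congr (h : ∀ i < j, w i = w' i) : partialSlope w j = partialSlope w' j :=
  Finset.sum_congr rfl fun i hi => by rw [h i (Finset.mem_range.1 hi)]

theorem monotone_partialSlope (w : ℕ → Fin B) : Monotone (partialSlope w) :=
  monotone_nat_of_le_succ fun j => by
    rw [partialSlope_succ]
    exact le_add_of_nonneg_right (by positivity)

theorem partialSlope_nonneg (w : ℕ → Fin B) (j : ℕ) : 0 ≤ partialSlope w j :=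
  partialSlope_zero w ▸ monotone_partialSlope w j.zero_le

theorem antitone_partialSlope_add (w : ℕ → Fin B) :
    Antitone fun j => partialSlope w j + 1 / (B : ℝ) ^ j := by
  refine antitone_nat_of_succ_le fun j => ?_
  have hB : (0 : ℝ) < B := by exact_mod_cast (w 0).pos
  have hdigit : (w j : ℝ) + 1 ≤ B := by exact_mod_cast (w j).is_lt
  calc partialSlope w (j + 1) + 1 / (B : ℝ) ^ (j + 1)
      = partialSlope w j + (w j + 1) / (B : ℝ) ^ (j + 1) := by rw [partialSlope_succ]; ring
    _ ≤ partialSlope w j + B / (B : ℝ) ^ (j + 1) := by gcongr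
    _ = partialSlope w j + 1 / (B : ℝ) ^ j := by
        rw [pow_succ', div_mul_cancel_left₀ hB.ne', one_div]

theorem partialSlope_le_one (w : ℕ → Fin B) (j : ℕ) : partialSlope w j ≤ 1 := by
  have hgap := antitone_partialSlope_add w j.zero_le
  simp only [partialSlope_zero, pow_zero, div_one, zero_add] at hgap
  linarith [show (0 : ℝ) ≤ 1 / (B : ℝ) ^ j by positivity]

theorem abs_partialSlope_le_one (w : ℕ → Fin B) (j : ℕ) : |partialSlope w j| ≤ 1 :=
  (abs_of_nonneg (partialSlope_nonneg w j)).trans_le (partialSlope_le_one w j)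

theorem abs_partialSlope_sub_le (hij : j ≤ i) :
    |partialSlope w i - partialSlope w j| ≤ 1 / (B : ℝ) ^ j - 1 / (B : ℝ) ^ i := by
  have hgap := antitone_partialSlope_add w hij
  simp only at hgap
  rw [abs_of_nonneg (sub_nonneg.2 (monotone_partialSlope w hij))]
  linarith

/-- The cone of aperture `5 * B ^ (-j)` in the half-plane `0 < s` around the line whose slope is
given by the first `j` digits. -/
def InCone (w : ℕ → Fin B) (j : ℕ) (s z : ℝ) : Prop :=
  |z - partialSlope w j * s| < 5 * (1 / (B : ℝ) ^ j) * s

theorem inCone_congr (h : ∀ i < j, w i = w' i) (s z : ℝ) : InCone w j s z ↔ InCone w' j s z := by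
  rw [InCone, InCone, partialSlope_congr h]

theorem InCone.pos {s z : ℝ} (h : InCone w j s z) : 0 < s := by
  have hB : (0 : ℝ) < B := by exact_mod_cast (w 0).pos
  exact pos_of_mul_pos_right ((abs_nonneg _).trans_lt h) (by positivity)

theorem antitone_one_div_base_pow (w : ℕ → Fin B) : Antitone fun j => 1 / (B : ℝ) ^ j := by
  intro j i hij
  have := abs_partialSlope_sub_le (w := w) hij
  simp only
  linarith [abs_nonneg (partialSlope w i - partialSlope w j)]

theorem InCone.anti {s z : ℝ} (hij : j ≤ i) (h : InCone w i s z) : InCone w j s z := by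
  have hs := h.pos
  have haperture := mul_le_mul_of_nonneg_right (antitone_one_div_base_pow w hij) hs.le
  have hslope : |(partialSlope w i - partialSlope w j) * s|
      ≤ (1 / (B : ℝ) ^ j - 1 / (B : ℝ) ^ i) * s := by
    rw [abs_mul, abs_of_pos hs]
    exact mul_le_mul_of_nonneg_right (abs_partialSlope_sub_le hij) hs.le
  have htriangle := abs_add_le (z - partialSlope w i * s)
    ((partialSlope w i - partialSlope w j) * s)
  have hcone := h
  unfold InCone at hcone ⊢
  rw [show z - partialSlope w j * s
    = z - partialSlope w i * s + (partialSlope w i - partialSlope w j) * s by ring]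
  linarith

open scoped Classical in
theorem card_filter_abs_sub_natCast_lt_le (u : ℝ) (n : ℕ) :
    (Finset.univ.filter fun c : Fin B => |u - c| < n).card ≤ 2 * n := by
  calc (Finset.univ.filter fun c : Fin B => |u - c| < n).card
      ≤ (Finset.Icc (⌊u⌋ - n + 1) (⌊u⌋ + n)).card := by
        refine Finset.card_le_card_of_injOn (fun c => ((c : ℕ) : ℤ)) (fun c hc => ?_)
          fun c _ c' _ h => Fin.ext (Int.ofNat.inj h)
        have hc := abs_lt.1 (Finset.mem_filter.1 hc).2
        have hlower : ⌊u⌋ < ((c + n : ℕ) : ℤ) := Int.floor_lt.2 (by push_cast; linarith)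
        have hupper : ((c : ℕ) : ℤ) - n ≤ ⌊u⌋ := Int.le_floor.2 (by push_cast; linarith)
        simp only [Finset.coe_Icc, Set.mem_Icc]
        push_cast at hlower
        omega
    _ = 2 * n := by
        rw [Int.card_Icc]
        omega

open scoped Classical in
theorem card_filter_inCone_update_le (w : ℕ → Fin B) (j : ℕ) (s z : ℝ) :
    (Finset.univ.filter fun c => InCone (Function.update w j c) (j + 1) s z).card ≤ 10 := by
  have hB : (0 : ℝ) < B := by exact_mod_cast (w 0).pos
  have hslope (c : Fin B) : partialSlope (Function.update w j c) (j + 1)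
      = partialSlope w j + c / B ^ (j + 1) := by
    rw [partialSlope_succ, Function.update_self, partialSlope_congr fun i hi =>
      Function.update_of_ne hi.ne _ _]
  refine (Finset.card_le_card fun c hc => ?_).trans
    (card_filter_abs_sub_natCast_lt_le ((z - partialSlope w j * s) * B ^ (j + 1) / s) 5)
  have hcone := (Finset.mem_filter.1 hc).2
  have hs := hcone.pos
  rw [InCone, hslope] at hcone
  refine Finset.mem_filter.2 ⟨Finset.mem_univ c, ?_⟩
  rw [show (z - partialSlope w j * s) * B ^ (j + 1) / s - c
      = (z - (partialSlope w j + c / B ^ (j + 1)) * s) * (B ^ (j + 1) / s) by field_simp; ring,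
    abs_mul, abs_of_pos (show 0 < (B : ℝ) ^ (j + 1) / s by positivity),
    ← lt_div_iff₀ (by positivity)]
  refine hcone.trans_eq ?_
  push_cast
  field_simp

end slopes

/-! ### Wedges -/

section wedges

variable {B : ℕ} {w w' : ℕ → Fin B} {a : ℝ} {i j k m : ℕ} {s z c : ℝ}

/-- A multiple of the distance of `(s, z)` from the line of slope `partialSlope w j`, corrected by a
linear term. It is nonnegative outside the cone `InCone w j`, and there it dominates
`sharpWedge w a i` for all `i > j`. -/
def sharpWedge (w : ℕ → Fin B) (a : ℝ) (j : ℕ) (s z : ℝ) : ℝ :=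
  a / 2 ^ j * (|z - partialSlope w j * s| - 2 * (1 / (B : ℝ) ^ j) * s)

/-- A twice differentiable version of `sharpWedge`. The shift by `2 * j` separates consecutive
wedges by more than the width of the transition region of `softMax`. -/
def wedge (w : ℕ → Fin B) (a : ℝ) (j : ℕ) (s z : ℝ) : ℝ :=
  softAbs (a / 2 ^ j * (z - partialSlope w j * s)) - 2 * (a / 2 ^ j) * (1 / (B : ℝ) ^ j) * s - 2 * j

theorem sharpWedge_sub_le_wedge (ha : 0 ≤ a) (s z : ℝ) :
    sharpWedge w a j s z - 2 * j ≤ wedge w a j s z := by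
  have := abs_le_softAbs (a / 2 ^ j * (z - partialSlope w j * s))
  rw [abs_mul, abs_of_nonneg (by positivity : 0 ≤ a / 2 ^ j)] at this
  unfold sharpWedge wedge
  linarith

theorem wedge_le_sharpWedge_sub_add (ha : 0 ≤ a) (s z : ℝ) :
    wedge w a j s z ≤ sharpWedge w a j s z - 2 * j + 1 / 6 := by
  have := softAbs_le (a / 2 ^ j * (z - partialSlope w j * s))
  rw [abs_mul, abs_of_nonneg (by positivity : 0 ≤ a / 2 ^ j)] at this
  unfold sharpWedge wedge
  linarith

theorem two_mul_le_abs_sub_of_not_inCone (h : ¬InCone w j s z) :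
    2 * (1 / (B : ℝ) ^ j) * s ≤ |z - partialSlope w j * s| := by
  have hq : (0 : ℝ) ≤ 1 / (B : ℝ) ^ j := by positivity
  rw [InCone, not_lt] at h
  rcases le_total 0 s with hs | hs
  · linarith [mul_nonneg hq hs]
  · exact (mul_nonpos_of_nonneg_of_nonpos (by linarith) hs).trans (abs_nonneg _)

theorem sharpWedge_nonneg (ha : 0 ≤ a) (h : ¬InCone w j s z) : 0 ≤ sharpWedge w a j s z :=
  mul_nonneg (by positivity) (sub_nonneg.2 (two_mul_le_abs_sub_of_not_inCone h))

theorem sharpWedge_anti (ha : 0 ≤ a) (h : ¬InCone w j s z) (hij : j < i) :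
    sharpWedge w a i s z ≤ sharpWedge w a j s z := by
  set qi := 1 / (B : ℝ) ^ i
  set qj := 1 / (B : ℝ) ^ j with hqj
  set Yi := |z - partialSlope w i * s| - 2 * qi * s
  set Yj := |z - partialSlope w j * s| - 2 * qj * s with hYj
  have hq₀ : 0 ≤ qi := by positivity
  have hq : qi ≤ qj := antitone_one_div_base_pow w hij.le
  have hdist : |z - partialSlope w i * s| ≤ |z - partialSlope w j * s| + (qj - qi) * |s| := by
    have hslope := mul_le_mul_of_nonneg_right (abs_partialSlope_sub_le (w := w) hij.le)
      (abs_nonneg s)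
    have := abs_sub (z - partialSlope w j * s) ((partialSlope w i - partialSlope w j) * s)
    rw [abs_mul, show z - partialSlope w j * s - (partialSlope w i - partialSlope w j) * s
      = z - partialSlope w i * s by ring] at this
    linarith
  have hhalf : Yi ≤ 2 * Yj := by
    have hcone := h
    rw [InCone, not_lt, ← hqj] at hcone
    rcases le_total 0 s with hs | hs
    · rw [abs_of_nonneg hs] at hdist
      linarith [mul_nonneg hq₀ hs]
    · rw [abs_of_nonpos hs] at hdist
      linarith [mul_le_mul_of_nonpos_right hq hs, abs_nonneg (z - partialSlope w j * s)]
  have hYj₀ : 0 ≤ Yj := sub_nonneg.2 (two_mul_le_abs_sub_of_not_inCone h)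
  calc sharpWedge w a i s z ≤ a / 2 ^ i * (2 * Yj) :=
        mul_le_mul_of_nonneg_left hhalf (by positivity)
    _ ≤ a / 2 ^ (j + 1) * (2 * Yj) := by
        gcongr
        · exact one_le_two
        · exact hij
    _ = sharpWedge w a j s z := by
        rw [sharpWedge, ← hqj, ← hYj]
        field_simp
        ring

theorem le_sharpWedge (ha : 0 ≤ a) (h : ¬InCone w j s z) :
    a / 2 ^ j * (1 / (B : ℝ) ^ j) / 4 * (|s| + |z|) ≤ sharpWedge w a j s z := by
  have hq₀ : 0 ≤ 1 / (B : ℝ) ^ j := by positivity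
  have hq₁ : 1 / (B : ℝ) ^ j ≤ 1 := by simpa using antitone_one_div_base_pow w j.zero_le
  have hz : |z| ≤ |z - partialSlope w j * s| + |s| := by
    have := abs_add_le (z - partialSlope w j * s) (partialSlope w j * s)
    rw [sub_add_cancel, abs_mul] at this
    linarith [mul_le_of_le_one_left (abs_nonneg s) (abs_partialSlope_le_one w j)]
  have hqz := mul_le_mul_of_nonneg_left hz hq₀
  have hqX := mul_le_of_le_one_left (abs_nonneg (z - partialSlope w j * s)) hq₁
  rw [InCone, not_lt] at h
  calc a / 2 ^ j * (1 / (B : ℝ) ^ j) / 4 * (|s| + |z|)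
      = a / 2 ^ j * (1 / (B : ℝ) ^ j * (|s| + |z|) / 4) := by ring
    _ ≤ sharpWedge w a j s z := by
        refine mul_le_mul_of_nonneg_left ?_ (by positivity)
        rcases le_total 0 s with hs | hs
        · rw [abs_of_nonneg hs] at hqz ⊢
          linarith [mul_nonneg hq₀ hs]
        · rw [abs_of_nonpos hs] at hqz ⊢
          linarith [mul_nonpos_of_nonneg_of_nonpos hq₀ hs, abs_nonneg (z - partialSlope w j * s)]

/-- The soft maximum of the wedges `j, …, j + k - 1` and of the constant `-2 * (j + k)`. -/
def wedgeChain (w : ℕ → Fin B) (a : ℝ) : ℕ → ℕ → ℝ → ℝ → ℝ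
  | 0, j => fun _ _ => -2 * j
  | k + 1, j => fun s z => softMax (wedge w a j s z) (wedgeChain w a k (j + 1) s z)

theorem wedgeChain_zero : wedgeChain w a 0 j s z = -2 * j := rfl

theorem wedgeChain_succ : wedgeChain w a (k + 1) j s z
    = softMax (wedge w a j s z) (wedgeChain w a k (j + 1) s z) := rfl

theorem neg_two_mul_le_wedgeChain : -2 * ((j : ℝ) + k) ≤ wedgeChain w a k j s z := by
  induction k generalizing j with
  | zero => simp [wedgeChain_zero]
  | succ k ih =>
    refine le_trans (le_of_eq ?_) ((ih (j := j + 1)).trans (le_softMax_right _ _))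
    push_cast
    ring

theorem wedge_le_wedgeChain (hj : i ≤ j) (hjk : j < i + k) :
    wedge w a j s z ≤ wedgeChain w a k i s z := by
  induction k generalizing i with
  | zero => omega
  | succ k ih =>
    rcases hj.eq_or_lt with rfl | hlt
    · exact le_softMax_left _ _
    · exact (ih hlt (by omega)).trans (le_softMax_right _ _)

theorem wedgeChain_le (ha : 0 ≤ a) (hc : 0 ≤ c)
    (h : ∀ j, i ≤ j → j < i + k → sharpWedge w a j s z ≤ c) :
    wedgeChain w a k i s z ≤ c - 2 * i + 1 / 3 := by
  induction k generalizing i with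
  | zero =>
    rw [wedgeChain_zero]
    linarith
  | succ k ih =>
    have hfirst := wedge_le_sharpWedge_sub_add (w := w) (j := i) ha s z
    have hrest := ih (i := i + 1) fun j hj hjk => h j (by omega) (by omega)
    push_cast at hrest
    rw [wedgeChain_succ]
    have hwedge := h i le_rfl (by omega)
    linarith [softMax_le (c := c - 2 * i + 1 / 6) (hfirst.trans (by linarith))
      (hrest.trans (by linarith))]

theorem wedgeChain_eq_wedge (ha : 0 ≤ a) (h : ¬InCone w j s z) :
    wedgeChain w a (k + 1) j s z = wedge w a j s z := by
  have hrest : wedgeChain w a k (j + 1) s z ≤ sharpWedge w a j s z - 2 * (j + 1 : ℕ) + 1 / 3 :=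
    wedgeChain_le ha (sharpWedge_nonneg ha h) fun i hi _ => sharpWedge_anti ha h hi
  have hfirst := sharpWedge_sub_le_wedge (w := w) (j := j) ha s z
  push_cast at hrest
  exact softMax_of_add_one_le (by linarith)

theorem wedgeChain_congr (ha : 0 ≤ a) (hw : ∀ n < j, w n = w' n) (h : ¬InCone w j s z)
    (hij : i ≤ j) : wedgeChain w a k i s z = wedgeChain w' a k i s z := by
  have hwedge {i : ℕ} (hi : i ≤ j) : wedge w a i s z = wedge w' a i s z := by
    simp only [wedge, partialSlope_congr fun n hn => hw n (hn.trans_le hi)]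
  induction k generalizing i with
  | zero => rfl
  | succ k ih =>
    rcases hij.eq_or_lt with rfl | hlt
    · rw [wedgeChain_eq_wedge ha h, wedgeChain_eq_wedge ha (mt (inCone_congr hw s z).2 h),
        hwedge le_rfl]
    · rw [wedgeChain_succ, wedgeChain_succ, hwedge hij, ih hlt]

theorem wedgeChain_le_of_slope_eq (ha : 0 ≤ a) (hs : 0 ≤ s) :
    wedgeChain w a (m + 1) 0 s (partialSlope w m * s) ≤ 1 / 3 := by
  refine (wedgeChain_le (c := 0) ha le_rfl fun j _ hj => ?_).trans (by norm_num)
  have hjm : j ≤ m := by omega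
  refine mul_nonpos_of_nonneg_of_nonpos (by positivity) (sub_nonpos.2 ?_)
  have hgap := abs_partialSlope_sub_le (w := w) hjm
  rw [← sub_mul, abs_mul, abs_of_nonneg hs]
  refine mul_le_mul_of_nonneg_right ?_ hs
  have hqj : (0 : ℝ) ≤ 1 / (B : ℝ) ^ j := by positivity
  have hqm : (0 : ℝ) ≤ 1 / (B : ℝ) ^ m := by positivity
  linarith

theorem wedgeChain_le_of_abs_le_one (ha : 0 ≤ a) (hs : |s| ≤ 1) (hz : |z| ≤ 1) :
    wedgeChain w a k 0 s z ≤ 4 * a + 1 / 3 := by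
  refine (wedgeChain_le (c := 4 * a) ha (by positivity) fun j _ _ => ?_).trans (by norm_num)
  have hq₀ : 0 ≤ 1 / (B : ℝ) ^ j := by positivity
  have hq₁ : 1 / (B : ℝ) ^ j ≤ 1 := by simpa using antitone_one_div_base_pow w j.zero_le
  have hbracket : |z - partialSlope w j * s| - 2 * (1 / (B : ℝ) ^ j) * s ≤ 4 := by
    have hslope : |partialSlope w j * s| ≤ 1 := by
      rw [abs_mul]
      exact mul_le_one₀ (abs_partialSlope_le_one w j) (abs_nonneg s) hs
    have haperture : |1 / (B : ℝ) ^ j * s| ≤ 1 := by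
      rw [abs_mul, abs_of_nonneg hq₀]
      exact mul_le_one₀ hq₁ (abs_nonneg s) hs
    linarith [abs_sub z (partialSlope w j * s), neg_abs_le (1 / (B : ℝ) ^ j * s)]
  calc sharpWedge w a j s z ≤ a / 2 ^ j * 4 := mul_le_mul_of_nonneg_left hbracket (by positivity)
    _ ≤ a * 4 := by
        gcongr
        exact div_le_self ha (one_le_pow₀ one_le_two)
    _ = 4 * a := mul_comm _ _

end wedges

section smoothWedges

variable {B : ℕ} {V : Type*} [NormedAddCommGroup V] [NormedSpace ℝ V] {σ ζ : V →L[ℝ] ℝ} {a : ℝ}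

theorem smoothConvex_wedge (w : ℕ → Fin B) (ha : 0 ≤ a) (j : ℕ) (hσ : ‖σ‖ ≤ 1) (hζ : ‖ζ‖ ≤ 1) :
    SmoothConvex (4 * a) (16 * a ^ 2) fun x => wedge w a j (σ x) (ζ x) := by
  have hscale : a / 2 ^ j ≤ a := div_le_self ha (one_le_pow₀ one_le_two)
  have hscale₀ : 0 ≤ a / 2 ^ j := by positivity
  have hq₁ : 1 / (B : ℝ) ^ j ≤ 1 := by simpa using antitone_one_div_base_pow w j.zero_le
  have hdist : ‖(a / 2 ^ j) • (ζ - partialSlope w j • σ)‖ ≤ 2 * a := by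
    have hslope : ‖partialSlope w j • σ‖ ≤ 1 := by
      rw [norm_smul]
      exact mul_le_one₀ (abs_partialSlope_le_one w j) (norm_nonneg σ) hσ
    rw [norm_smul, Real.norm_of_nonneg hscale₀, mul_comm 2]
    exact mul_le_mul hscale (by linarith [norm_sub_le ζ (partialSlope w j • σ)]) (norm_nonneg _) ha
  have hlinear : ‖(-(2 * (a / 2 ^ j) * (1 / (B : ℝ) ^ j))) • σ‖ ≤ 2 * a := by
    rw [norm_smul, norm_neg, Real.norm_of_nonneg (by positivity)]
    calc 2 * (a / 2 ^ j) * (1 / (B : ℝ) ^ j) * ‖σ‖ ≤ 2 * a * 1 * 1 := by gcongr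
      _ = 2 * a := by ring
  convert ((SmoothConvex.softAbs ((a / 2 ^ j) • (ζ - partialSlope w j • σ))).add
    (SmoothConvex.affine ((-(2 * (a / 2 ^ j) * (1 / (B : ℝ) ^ j))) • σ) (-(2 * j)))).mono
    (L' := 4 * a) (H' := 16 * a ^ 2) (by linarith) ?_ using 2 with x
  · simp only [wedge, smul_apply, sub_apply, smul_eq_mul]
    ring
  · nlinarith [norm_nonneg ((a / 2 ^ j) • (ζ - partialSlope w j • σ))]

theorem smoothConvex_wedgeChain (w : ℕ → Fin B) (ha : 0 ≤ a) (hσ : ‖σ‖ ≤ 1) (hζ : ‖ζ‖ ≤ 1)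
    (k j : ℕ) : SmoothConvex (4 * a) (16 * a ^ 2 + k * (8 * a) ^ 2)
      fun x => wedgeChain w a k j (σ x) (ζ x) := by
  induction k generalizing j with
  | zero =>
    simpa [wedgeChain_zero] using (SmoothConvex.affine (0 : V →L[ℝ] ℝ) (-2 * j)).mono
      (L' := 4 * a) (H' := 16 * a ^ 2) (by simpa using ha) (by positivity)
  | succ k ih =>
    have hwedge := (smoothConvex_wedge w ha j hσ hζ).mono le_rfl
      (le_add_of_nonneg_right (by positivity : 0 ≤ (k : ℝ) * (8 * a) ^ 2))
    refine (hwedge.softMax (ih (j + 1))).mono le_rfl (le_of_eq ?_)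
    push_cast
    ring

end smoothWedges

/-! ### Gibbs measures -/

theorem integral_exp_neg_mul_abs {v : ℝ} (hv : 0 < v) :
    ∫ t : ℝ, Real.exp (-(v * |t|)) = 2 / v := by
  rw [integral_comp_abs (f := fun t => Real.exp (-(v * t)))]
  have hhalf := integral_exp_mul_Ioi (neg_lt_zero.2 hv) 0
  rw [mul_zero, Real.exp_zero, neg_div_neg_eq] at hhalf
  simp only [← neg_mul, hhalf]
  ring

section gibbs

variable {d : ℕ} {f : Eucl d → ℝ}

theorem integral_exp_neg_sum_mul_abs {v : Fin d → ℝ} (hv : ∀ i, 0 < v i) :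
    ∫ x : Eucl d, Real.exp (-∑ i, v i * |x i|) = ∏ i, 2 / v i := by
  rw [(PiLp.volume_preserving_ofLp (Fin d)).integral_comp
    (MeasurableEquiv.toLp 2 (Fin d → ℝ)).symm.measurableEmbedding
    (fun x : Fin d → ℝ => Real.exp (-∑ i, v i * |x i|))]
  simp_rw [← Finset.sum_neg_distrib, Real.exp_sum]
  rw [integral_fintype_prod_volume_eq_prod (f := fun i t => Real.exp (-(v i * |t|)))]
  exact Finset.prod_congr rfl fun i _ => integral_exp_neg_mul_abs (hv i)

theorem integrable_exp_neg_sum_mul_abs {v : Fin d → ℝ} (hv : ∀ i, 0 < v i) :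
    Integrable fun x : Eucl d => Real.exp (-∑ i, v i * |x i|) := by
  refine not_imp_comm.1 integral_undef ?_
  rw [integral_exp_neg_sum_mul_abs hv]
  exact (Finset.prod_pos fun i _ => div_pos two_pos (hv i)).ne'

theorem pow_le_volume_real_ball (hd : 0 < d) (x : Eucl d) {r : ℝ} (hr : 0 < r) :
    (2 * r / d) ^ d ≤ volume.real (Metric.ball x r) := by
  have : Nonempty (Fin d) := ⟨⟨0, hd⟩⟩
  have hr' : 0 < r / d := by positivity
  have hcube := Real.volume_pi_ball (x : Fin d → ℝ) hr'
  rw [Fintype.card_fin, ← mul_div_assoc] at hcube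
  rw [measureReal_def, ← ENNReal.ofReal_le_iff_le_toReal measure_ball_lt_top.ne, ← hcube,
    ← (PiLp.volume_preserving_ofLp (Fin d)).measure_preimage measurableSet_ball.nullMeasurableSet]
  refine measure_mono fun y hy => mem_ball_iff_norm.2 (lt_of_pow_lt_pow_left₀ 2 hr.le ?_)
  rw [Set.mem_preimage, mem_ball_iff_norm, pi_norm_lt_iff hr'] at hy
  rw [EuclideanSpace.norm_sq_eq]
  calc ∑ i, ‖(y - x) i‖ ^ 2 < ∑ _i : Fin d, (r / d) ^ 2 :=
        Finset.sum_lt_sum_of_nonempty Finset.univ_nonempty fun i _ =>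
          pow_lt_pow_left₀ (hy i) (norm_nonneg _) two_ne_zero
    _ = r ^ 2 / d := by
        rw [Finset.sum_const, Finset.card_univ, Fintype.card_fin, nsmul_eq_mul]
        field_simp
    _ ≤ r ^ 2 := div_le_self (sq_nonneg r) (by exact_mod_cast hd)

theorem gibbs_real_apply (f : Eucl d → ℝ) {s : Set (Eucl d)} (hs : MeasurableSet s) :
    (gibbs f).real s = (∫ x in s, Real.exp (-f x)) / ∫ x, Real.exp (-f x) := by
  have hnonneg : 0 ≤ ∫ x in s, Real.exp (-f x) / ∫ x, Real.exp (-f x) :=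
    integral_nonneg fun x => div_nonneg (Real.exp_pos _).le (integral_nonneg fun _ =>
      (Real.exp_pos _).le)
  rw [measureReal_def, gibbs, tilted_apply_eq_ofReal_integral' _ hs, ENNReal.toReal_ofReal hnonneg,
    integral_div]

theorem renyiInf_le {X : Type*} [MeasurableSpace X] {μ ν : Measure X} [IsFiniteMeasure μ]
    [IsFiniteMeasure ν] {M : ℝ} (h : ∀ s, MeasurableSet s →
      μ s ≤ ENNReal.ofReal (Real.exp M) * ν s) : renyiInf μ ν ≤ M := by
  have hac : μ ≪ ν := Measure.AbsolutelyContinuous.mk fun s hs hνs =>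
    nonpos_iff_eq_zero.1 ((h s hs).trans_eq (by rw [hνs, mul_zero]))
  have hle : μ.rnDeriv ν ≤ᵐ[ν] fun _ => ENNReal.ofReal (Real.exp M) := by
    refine ae_le_of_forall_setLIntegral_le_of_sigmaFinite (Measure.measurable_rnDeriv μ ν)
      fun s hs _ => ?_
    rw [setLIntegral_const]
    exact (Measure.setLIntegral_rnDeriv_le s).trans (h s hs)
  calc renyiInf μ ν = ENNReal.log (essSup (μ.rnDeriv ν) ν) := if_pos hac
    _ ≤ ENNReal.log (ENNReal.ofReal (Real.exp M)) :=
        ENNReal.log_monotone (essSup_le_of_ae_le _ hle)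
    _ = M := by rw [ENNReal.log_ofReal_of_pos (Real.exp_pos M), Real.log_exp]

theorem volume_le_mul_gibbs (hf : Integrable fun x => Real.exp (-f x)) {s : Set (Eucl d)}
    (hs : MeasurableSet s) {b : ℝ} (hb : ∀ x ∈ s, f x ≤ b) :
    volume s ≤ ENNReal.ofReal (Real.exp b * ∫ x, Real.exp (-f x)) * gibbs f s := by
  have hZ : 0 < ∫ x, Real.exp (-f x) := integral_exp_pos hf
  rw [gibbs, tilted_apply' _ _ hs, ← lintegral_const_mul' _ _ ENNReal.ofReal_ne_top,
    ← setLIntegral_one s]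
  refine setLIntegral_mono' hs fun x hx => ?_
  rw [← ENNReal.ofReal_mul (by positivity), ← ENNReal.ofReal_one]
  refine ENNReal.ofReal_le_ofReal ?_
  rw [mul_assoc, mul_div_cancel₀ _ hZ.ne', ← Real.exp_add]
  exact Real.one_le_exp (by linarith [hb x hx])

theorem renyiInf_cond_gibbs_le (hf : Integrable fun x => Real.exp (-f x)) {s : Set (Eucl d)}
    (hs : MeasurableSet s) (hs₀ : volume s ≠ 0) (hs₁ : volume s ≠ ⊤) {b : ℝ}
    (hb : ∀ x ∈ s, f x ≤ b) :
    renyiInf (ProbabilityTheory.cond volume s) (gibbs f) ≤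
      ((b + Real.log (∫ x, Real.exp (-f x)) - Real.log (volume.real s) : ℝ) : EReal) := by
  have : IsProbabilityMeasure (gibbs f) := isProbabilityMeasure_tilted hf
  have := ProbabilityTheory.cond_isProbabilityMeasure_of_finite hs₀ hs₁
  have hvol : 0 < volume.real s := ENNReal.toReal_pos hs₀ hs₁
  refine renyiInf_le fun t ht => ?_
  rw [ProbabilityTheory.cond_apply hs, Real.exp_sub, Real.exp_add,
    Real.exp_log (integral_exp_pos hf), Real.exp_log hvol, ENNReal.ofReal_div_of_pos hvol,
    ofReal_measureReal hs₁, mul_comm, ← div_eq_mul_inv, ← ENNReal.mul_div_right_comm]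
  gcongr
  exact (volume_le_mul_gibbs hf (hs.inter ht) fun x hx => hb x hx.1).trans
    (by gcongr; exact Set.inter_subset_right)

theorem card_mul_volume_ball_mul_exp_le_integral {L : NNReal} (hL : LipschitzWith L f)
    (hf : Integrable fun x => Real.exp (-f x)) {ι : Type*} {S : Finset ι} {p : ι → Eucl d} {r : ℝ}
    (hp : (S : Set ι).Pairwise fun k l => 2 * r ≤ dist (p k) (p l)) {b : ℝ}
    (hb : ∀ k ∈ S, f (p k) ≤ b) :
    S.card * volume.real (Metric.ball (0 : Eucl d) r) * Real.exp (-(b + L * r)) ≤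
      ∫ x, Real.exp (-f x) := by
  set U := ⋃ k ∈ S, Metric.ball (p k) r with hU
  have hvol : volume U = S.card * volume (Metric.ball (0 : Eucl d) r) := by
    rw [hU, measure_biUnion_finset (fun k hk l hl hkl => Metric.ball_disjoint_ball
      (by linarith [hp hk hl hkl])) fun _ _ => measurableSet_ball]
    simp only [Measure.addHaar_ball_center, Finset.sum_const, nsmul_eq_mul]
  have hfinite : volume U ≠ ⊤ := by
    rw [hvol]
    exact ENNReal.mul_ne_top (ENNReal.natCast_ne_top _) measure_ball_lt_top.ne
  have hbound : ∀ x ∈ U, Real.exp (-(b + L * r)) ≤ Real.exp (-f x) := fun x hx => by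
    obtain ⟨k, hk, hxk⟩ := Set.mem_iUnion₂.1 hx
    have hdist : f x - f (p k) ≤ L * r := (le_abs_self _).trans <| (hL.dist_le_mul x (p k)).trans <|
      mul_le_mul_of_nonneg_left (Metric.mem_ball.1 hxk).le L.2
    exact Real.exp_le_exp.2 (by linarith [hb k hk])
  calc S.card * volume.real (Metric.ball (0 : Eucl d) r) * Real.exp (-(b + L * r))
      = ∫ _ in U, Real.exp (-(b + L * r)) := by
        rw [setIntegral_const, smul_eq_mul, measureReal_def, measureReal_def, hvol,
          ENNReal.toReal_mul, ENNReal.toReal_natCast]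
    _ ≤ ∫ x in U, Real.exp (-f x) :=
        setIntegral_mono_on (integrableOn_const hfinite) hf.integrableOn
          (Finset.measurableSet_biUnion _ fun _ _ => measurableSet_ball) hbound
    _ ≤ ∫ x, Real.exp (-f x) :=
        setIntegral_le_integral hf (Eventually.of_forall fun x => (Real.exp_pos _).le)

end gibbs

/-- The uniform distribution on the unit ball, the warm start for all hard potentials. -/
def uniformBall (d : ℕ) : Measure (Eucl d) :=
  ProbabilityTheory.cond volume (Metric.ball (0 : Eucl d) 1)

instance isProbabilityMeasure_uniformBall (d : ℕ) : IsProbabilityMeasure (uniformBall d) :=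
  ProbabilityTheory.cond_isProbabilityMeasure_of_finite
    (Metric.measure_ball_pos volume _ one_pos).ne' measure_ball_lt_top.ne

theorem measureReal_sub_le_tvDist {X : Type*} [MeasurableSpace X] (μ ν : Measure X)
    [IsProbabilityMeasure μ] [IsProbabilityMeasure ν] {s : Set X} (hs : MeasurableSet s) :
    ν.real s - μ.real s ≤ tvDist μ ν := by
  have hbdd : BddAbove (Set.range fun A : {A : Set X // MeasurableSet A} =>
      |μ.real A.1 - ν.real A.1|) := by
    refine ⟨1, Set.forall_mem_range.2 fun A => abs_sub_le_of_nonneg_of_le ?_ ?_ ?_ ?_⟩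
    exacts [measureReal_nonneg, measureReal_le_one, measureReal_nonneg, measureReal_le_one]
  calc ν.real s - μ.real s ≤ |μ.real s - ν.real s| := (le_abs_self _).trans_eq (abs_sub_comm _ _)
    _ ≤ tvDist μ ν := le_ciSup hbdd ⟨s, hs⟩

/-! ### The hard potentials -/

section needle

variable {B d : ℕ} {w w' : ℕ → Fin B} {K j : ℕ} {i₀ i₁ : Fin d} {β : ℝ}

/-- The points whose coordinates `i₀` and `i₁` lie in the cone given by the first `j` digits. -/
def slopeCone (w : ℕ → Fin B) (j : ℕ) (i₀ i₁ : Fin d) : Set (Eucl d) :=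
  {x | InCone w j (x i₀) (x i₁)}

theorem measurableSet_slopeCone (w : ℕ → Fin B) (j : ℕ) (i₀ i₁ : Fin d) :
    MeasurableSet (slopeCone w j i₀ i₁) := by
  refine (isOpen_lt (f := fun x : Eucl d => |x i₁ - partialSlope w j * x i₀|)
    (g := fun x => 5 * (1 / (B : ℝ) ^ j) * x i₀) ?_ ?_).measurableSet <;> fun_prop

/-- The weights of a sum over the coordinates: `β` on the plane of the coordinates `i₀` and `i₁`,
and `1 / (8 * d)` on the others. -/
def planeWeight (β : ℝ) (i₀ i₁ i : Fin d) : ℝ :=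
  if i ∈ ({i₀, i₁} : Finset (Fin d)) then β else 1 / (8 * d)

theorem planeWeight_pos (hβ : 0 < β) (i₀ i₁ i : Fin d) : 0 < planeWeight β i₀ i₁ i := by
  have hd : (0 : ℝ) < d := by exact_mod_cast i.pos
  unfold planeWeight
  split_ifs <;> positivity

theorem sum_planeWeight_le (hβ : β ≤ 1 / (8 * d)) (i₀ i₁ : Fin d) :
    ∑ i, planeWeight β i₀ i₁ i ≤ 1 / 8 := by
  have hd : (0 : ℝ) < d := by exact_mod_cast i₀.pos
  calc ∑ i, planeWeight β i₀ i₁ i ≤ ∑ _i : Fin d, 1 / (8 * (d : ℝ)) :=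
        Finset.sum_le_sum fun i _ => by
          unfold planeWeight
          split_ifs
          exacts [hβ, le_rfl]
    _ = 1 / 8 := by
        rw [Finset.sum_const, Finset.card_univ, Fintype.card_fin, nsmul_eq_mul]
        field_simp

theorem sum_planeWeight_mul (hi : i₀ ≠ i₁) (y : Fin d → ℝ) :
    ∑ i, planeWeight β i₀ i₁ i * y i
      = β * (y i₀ + y i₁) + 1 / (8 * d) * ∑ i ∈ ({i₀, i₁} : Finset (Fin d))ᶜ, y i := by
  rw [← Finset.sum_add_sum_compl {i₀, i₁}, mul_add, ← Finset.sum_pair (f := fun i => β * y i) hi,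
    Finset.mul_sum]
  congr 1 <;> refine Finset.sum_congr rfl fun i hmem => ?_
  · rw [planeWeight, if_pos hmem]
  · rw [planeWeight, if_neg (Finset.mem_compl.1 hmem)]

theorem prod_two_div_planeWeight_le (hi : i₀ ≠ i₁) (β : ℝ) :
    ∏ i, 2 / planeWeight β i₀ i₁ i ≤ (2 / β) ^ 2 * (16 * d) ^ d := by
  have hd : (1 : ℝ) ≤ d := by exact_mod_cast i₀.pos
  have hplane : ∏ i ∈ {i₀, i₁}, 2 / planeWeight β i₀ i₁ i = (2 / β) ^ 2 := by
    rw [Finset.prod_congr rfl fun i hmem => by rw [planeWeight, if_pos hmem], Finset.prod_const,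
      Finset.card_pair hi]
  have hrest : ∏ i ∈ {i₀, i₁}ᶜ, 2 / planeWeight β i₀ i₁ i
      = (16 * d) ^ ({i₀, i₁} : Finset (Fin d))ᶜ.card := by
    refine Finset.prod_eq_pow_card fun i hmem => ?_
    rw [planeWeight, if_neg (Finset.mem_compl.1 hmem)]
    field_simp
    norm_num
  rw [← Finset.prod_mul_prod_compl {i₀, i₁}, hplane, hrest]
  gcongr
  · linarith
  · exact (Finset.card_le_univ _).trans_eq (Fintype.card_fin d)

theorem setIntegral_exp_neg_le_of_le (hβ : 0 < β) (hi : i₀ ≠ i₁) {f : Eucl d → ℝ}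
    {s : Set (Eucl d)} (hs : MeasurableSet s) {b : ℝ}
    (h : ∀ x ∈ s, b + ∑ i, planeWeight β i₀ i₁ i * |x i| ≤ f x) :
    ∫ x in s, Real.exp (-f x) ≤ Real.exp (-b) * ((2 / β) ^ 2 * (16 * d) ^ d) := by
  have hpos := planeWeight_pos (d := d) hβ i₀ i₁
  have hint := (integrable_exp_neg_sum_mul_abs hpos).const_mul (Real.exp (-b))
  calc ∫ x in s, Real.exp (-f x)
      ≤ ∫ x in s, Real.exp (-b) * Real.exp (-∑ i, planeWeight β i₀ i₁ i * |x i|) := by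
        refine integral_mono_of_nonneg (Eventually.of_forall fun x => (Real.exp_pos _).le)
          hint.integrableOn (ae_restrict_of_forall_mem hs fun x hx => ?_)
        simp only [← Real.exp_add]
        exact Real.exp_le_exp.2 (by linarith [h x hx])
    _ ≤ ∫ x : Eucl d, Real.exp (-b) * Real.exp (-∑ i, planeWeight β i₀ i₁ i * |x i|) :=
        setIntegral_le_integral hint (Eventually.of_forall fun x => by positivity)
    _ = Real.exp (-b) * ∏ i, 2 / planeWeight β i₀ i₁ i := by
        rw [integral_const_mul, integral_exp_neg_sum_mul_abs hpos]
    _ ≤ Real.exp (-b) * ((2 / β) ^ 2 * (16 * d) ^ d) := by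
        gcongr
        exact prod_two_div_planeWeight_le hi β

/-- The hard potential with digits `w`: the chain of the wedges `0, …, d` in the plane of the
coordinates `i₀` and `i₁`, and a small multiple of the `ℓ¹` norm that makes `exp (-needle)`
integrable. In this plane the multiple is `1 / K`, so that the Gibbs measure extends over a part of
length `K` of the innermost cone. -/
def needle (w : ℕ → Fin B) (K : ℕ) (i₀ i₁ : Fin d) (x : Eucl d) : ℝ :=
  wedgeChain w (1 / (16 * (d + 1))) (d + 1) 0 (x i₀) (x i₁) +
    ∑ i, planeWeight (1 / K) i₀ i₁ i * softAbs (x i)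

theorem needle_congr (hw : ∀ n < j, w n = w' n) {x : Eucl d}
    (hx : x ∉ slopeCone w j i₀ i₁) : needle w K i₀ i₁ x = needle w' K i₀ i₁ x := by
  rw [needle, needle, wedgeChain_congr (by positivity) hw hx j.zero_le]

theorem norm_euclideanProj_le (i : Fin d) :
    ‖(EuclideanSpace.proj i : Eucl d →L[ℝ] ℝ)‖ ≤ 1 :=
  ContinuousLinearMap.opNorm_le_bound _ zero_le_one fun x => by
    simpa using PiLp.norm_apply_le x i

theorem one_div_le_of_le (hK : 8 * d ≤ K) (i : Fin d) : 1 / (K : ℝ) ≤ 1 / (8 * d) := by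
  have hd : (0 : ℝ) < d := by exact_mod_cast i.pos
  exact one_div_le_one_div_of_le (by positivity) (by exact_mod_cast hK)

theorem cast_pos_of_le (hK : 8 * d ≤ K) (i : Fin d) : (0 : ℝ) < K := by
  have := i.pos
  exact_mod_cast (by omega : 0 < K)

theorem smoothConvex_needle (w : ℕ → Fin B) (hK : 8 * d ≤ K) (i₀ i₁ : Fin d) :
    SmoothConvex 1 1 (needle w K i₀ i₁) := by
  have hK₀ := cast_pos_of_le hK i₀
  have hsum := sum_planeWeight_le (one_div_le_of_le hK i₀) i₀ i₁
  have hchain := smoothConvex_wedgeChain (a := 1 / (16 * ((d : ℝ) + 1))) w (by positivity)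
    (norm_euclideanProj_le i₀) (norm_euclideanProj_le i₁) (d + 1) 0
  have habs (i : Fin d) : SmoothConvex 1 4 fun x : Eucl d => softAbs (x i) := by
    refine (SmoothConvex.softAbs (EuclideanSpace.proj i)).mono (norm_euclideanProj_le i) ?_
    nlinarith [norm_euclideanProj_le i, norm_nonneg (EuclideanSpace.proj i : Eucl d →L[ℝ] ℝ)]
  have hℓ₁ := SmoothConvex.sum Finset.univ fun i _ =>
    (habs i).const_mul (planeWeight_pos (one_div_pos.2 hK₀) i₀ i₁ i).le
  refine (hchain.add hℓ₁).mono ?_ ?_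
  · have hscale : 4 * (1 / (16 * ((d : ℝ) + 1))) ≤ 1 / 4 := by
      rw [mul_one_div, div_le_div_iff₀ (by positivity) (by norm_num)]
      linarith [(Nat.cast_nonneg d : (0 : ℝ) ≤ d)]
    simp only [mul_one]
    linarith
  · have hscale : 16 * (1 / (16 * ((d : ℝ) + 1))) ^ 2 +
        ((d + 1 : ℕ) : ℝ) * (8 * (1 / (16 * ((d : ℝ) + 1)))) ^ 2 ≤ 1 / 2 := by
      have : (0 : ℝ) ≤ d := Nat.cast_nonneg d
      push_cast
      field_simp
      norm_num
      nlinarith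
    rw [← Finset.sum_mul]
    linarith

theorem le_needle (w : ℕ → Fin B) (K : ℕ) (i₀ i₁ : Fin d) (x : Eucl d) :
    wedgeChain w (1 / (16 * (d + 1))) (d + 1) 0 (x i₀) (x i₁) +
      ∑ i, planeWeight (1 / K) i₀ i₁ i * |x i| ≤ needle w K i₀ i₁ x := by
  refine add_le_add_right (Finset.sum_le_sum fun i _ => ?_) _
  refine mul_le_mul_of_nonneg_left (abs_le_softAbs _) ?_
  unfold planeWeight
  split_ifs <;> positivity

theorem needle_le (w : ℕ → Fin B) (hK : 8 * d ≤ K) (i₀ i₁ : Fin d) (x : Eucl d) :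
    needle w K i₀ i₁ x ≤ wedgeChain w (1 / (16 * (d + 1))) (d + 1) 0 (x i₀) (x i₁) +
      ∑ i, planeWeight (1 / K) i₀ i₁ i * |x i| + 1 / 48 := by
  have hpos := planeWeight_pos (one_div_pos.2 (cast_pos_of_le hK i₀)) i₀ i₁
  have hsum : ∑ i, planeWeight (1 / K) i₀ i₁ i * softAbs (x i)
      ≤ ∑ i, planeWeight (1 / K) i₀ i₁ i * (|x i| + 1 / 6) :=
    Finset.sum_le_sum fun i _ => mul_le_mul_of_nonneg_left (softAbs_le _) (hpos i).le
  simp only [mul_add, Finset.sum_add_distrib, ← Finset.sum_mul] at hsum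
  rw [needle]
  linarith [sum_planeWeight_le (one_div_le_of_le hK i₀) i₀ i₁]

theorem neg_add_sum_le_needle (w : ℕ → Fin B) (K : ℕ) (i₀ i₁ : Fin d) (x : Eucl d) :
    -(2 * (d + 1) : ℝ) + ∑ i, planeWeight (1 / K) i₀ i₁ i * |x i| ≤ needle w K i₀ i₁ x := by
  have hchain := neg_two_mul_le_wedgeChain (w := w) (a := 1 / (16 * ((d : ℝ) + 1))) (k := d + 1)
    (j := 0) (s := x i₀) (z := x i₁)
  push_cast at hchain
  linarith [le_needle w K i₀ i₁ x]

theorem integral_exp_neg_needle_le (w : ℕ → Fin B) (hK : 8 * d ≤ K) (hi : i₀ ≠ i₁) :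
    ∫ x, Real.exp (-needle w K i₀ i₁ x)
      ≤ Real.exp (2 * (d + 1)) * ((2 * K) ^ 2 * (16 * d) ^ d) := by
  have hK₀ := cast_pos_of_le hK i₀
  have h := setIntegral_exp_neg_le_of_le (one_div_pos.2 hK₀) hi MeasurableSet.univ
    fun x _ => neg_add_sum_le_needle w K i₀ i₁ x
  rwa [setIntegral_univ, neg_neg, div_div_eq_mul_div, div_one] at h

theorem integrable_exp_neg_needle (w : ℕ → Fin B) (hK : 8 * d ≤ K) (i₀ i₁ : Fin d) :
    Integrable fun x => Real.exp (-needle w K i₀ i₁ x) := by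
  have hcont : Continuous (needle w K i₀ i₁) := (smoothConvex_needle w hK i₀ i₁).diff.continuous
  refine ((integrable_exp_neg_sum_mul_abs (planeWeight_pos (one_div_pos.2 (cast_pos_of_le hK i₀))
    i₀ i₁)).const_mul (Real.exp (2 * (d + 1)))).mono' hcont.neg.rexp.aestronglyMeasurable
      (Eventually.of_forall fun x => ?_)
  rw [Real.norm_of_nonneg (Real.exp_pos _).le, ← Real.exp_add]
  exact Real.exp_le_exp.2 (by linarith [neg_add_sum_le_needle w K i₀ i₁ x])

theorem neg_add_sum_le_needle_of_notMem (hi : i₀ ≠ i₁) {x : Eucl d}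
    (hx : x ∉ slopeCone w d i₀ i₁) :
    -(2 * d : ℝ) + ∑ i, planeWeight (1 / (64 * (d + 1) * 2 ^ d * B ^ d)) i₀ i₁ i * |x i|
      ≤ needle w K i₀ i₁ x := by
  have ha : (0 : ℝ) ≤ 1 / (16 * (d + 1)) := by positivity
  have hwedge := wedge_le_wedgeChain (w := w) (a := 1 / (16 * ((d : ℝ) + 1))) (s := x i₀)
    (z := x i₁) d.zero_le (k := d + 1) (by omega)
  have hsharp := sharpWedge_sub_le_wedge (w := w) (j := d) ha (x i₀) (x i₁)
  have hcone := le_sharpWedge ha hx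
  rw [show 1 / (16 * ((d : ℝ) + 1)) / 2 ^ d * (1 / (B : ℝ) ^ d) / 4
    = 1 / (64 * (d + 1) * 2 ^ d * B ^ d) by field_simp; norm_num] at hcone
  have hplane : 0 ≤ 1 / (K : ℝ) * (|x i₀| + |x i₁|) := by positivity
  have hsum := sum_planeWeight_mul (β := 1 / K) hi fun i => |x i|
  rw [sum_planeWeight_mul hi]
  linarith [le_needle w K i₀ i₁ x]

theorem setIntegral_compl_slopeCone_le (w : ℕ → Fin B) (K : ℕ) (hi : i₀ ≠ i₁) :
    ∫ x in (slopeCone w d i₀ i₁)ᶜ, Real.exp (-needle w K i₀ i₁ x)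
      ≤ Real.exp (2 * d) * ((128 * (d + 1) * 2 ^ d * B ^ d) ^ 2 * (16 * d) ^ d) := by
  have hB : (0 : ℝ) < B := by exact_mod_cast (w 0).pos
  have h := setIntegral_exp_neg_le_of_le (β := 1 / (64 * (d + 1) * 2 ^ d * B ^ d)) (by positivity)
    hi (measurableSet_slopeCone w d i₀ i₁).compl
    fun x hx => neg_add_sum_le_needle_of_notMem (w := w) (K := K) hi hx
  rw [neg_neg, div_div_eq_mul_div, div_one] at h
  refine h.trans_eq ?_
  ring

/-- Points on the ray along which the Gibbs measure of `needle w` is concentrated. -/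
def needlePoint (w : ℕ → Fin B) (i₀ i₁ : Fin d) (k : ℕ) : Eucl d :=
  EuclideanSpace.single i₀ (k : ℝ) + EuclideanSpace.single i₁ (partialSlope w d * k)

theorem needlePoint_fst (w : ℕ → Fin B) (hi : i₀ ≠ i₁) (k : ℕ) :
    needlePoint w i₀ i₁ k i₀ = k := by
  simp [needlePoint, hi]

theorem needlePoint_snd (w : ℕ → Fin B) (hi : i₀ ≠ i₁) (k : ℕ) :
    needlePoint w i₀ i₁ k i₁ = partialSlope w d * k := by
  simp [needlePoint, hi.symm]

theorem needle_needlePoint_le (w : ℕ → Fin B) (hK : 8 * d ≤ K) (hi : i₀ ≠ i₁) {k : ℕ}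
    (hk : k ≤ K) : needle w K i₀ i₁ (needlePoint w i₀ i₁ k) ≤ 3 := by
  have hK₀ := cast_pos_of_le hK i₀
  have hchain := wedgeChain_le_of_slope_eq (w := w) (a := 1 / (16 * ((d : ℝ) + 1))) (m := d)
    (by positivity) (Nat.cast_nonneg k)
  have hrest : ∑ i ∈ {i₀, i₁}ᶜ, |needlePoint w i₀ i₁ k i| = 0 := by
    refine Finset.sum_eq_zero fun i hmem => ?_
    simp only [Finset.mem_compl, Finset.mem_insert, Finset.mem_singleton, not_or] at hmem
    simp [needlePoint, hmem.1, hmem.2]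
  have hplane : 1 / (K : ℝ) * (k + |partialSlope w d * k|) ≤ 2 := by
    rw [one_div_mul_eq_div, div_le_iff₀ hK₀, abs_mul, Nat.abs_cast]
    have hkK : (k : ℝ) ≤ K := by exact_mod_cast hk
    linarith [mul_le_of_le_one_left (Nat.cast_nonneg k) (abs_partialSlope_le_one w d)]
  have hle := needle_le w hK i₀ i₁ (needlePoint w i₀ i₁ k)
  rw [sum_planeWeight_mul hi, hrest, needlePoint_fst w hi, needlePoint_snd w hi, Nat.abs_cast]
    at hle
  linarith

theorem natCast_le_integral_exp_neg_needle (w : ℕ → Fin B) (hK : 8 * d ≤ K) (hi : i₀ ≠ i₁) :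
    K * (1 / d : ℝ) ^ d * Real.exp (-4) ≤ ∫ x, Real.exp (-needle w K i₀ i₁ x) := by
  have hsep : ((Finset.range K : Finset ℕ) : Set ℕ).Pairwise fun k l =>
      2 * (1 / 2) ≤ dist (needlePoint w i₀ i₁ k) (needlePoint w i₀ i₁ l) := fun k _ l _ hkl => by
    have hcoord := PiLp.norm_apply_le (needlePoint w i₀ i₁ k - needlePoint w i₀ i₁ l) i₀
    rw [PiLp.sub_apply, needlePoint_fst w hi, needlePoint_fst w hi, ← dist_eq_norm] at hcoord
    have hint : (1 : ℤ) ≤ |(k : ℤ) - l| := Int.one_le_abs (by omega)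
    calc 2 * (1 / 2) = (1 : ℝ) := by norm_num
      _ ≤ |(k : ℝ) - l| := by exact_mod_cast hint
      _ ≤ dist (needlePoint w i₀ i₁ k) (needlePoint w i₀ i₁ l) := hcoord
  have hpack := card_mul_volume_ball_mul_exp_le_integral
    (SmoothConvex.lipschitzWith (L := 1) (smoothConvex_needle w hK i₀ i₁))
    (integrable_exp_neg_needle w hK i₀ i₁) hsep
    (fun k hk => needle_needlePoint_le w hK hi (Finset.mem_range.1 hk).le)
  rw [Finset.card_range] at hpack
  have hvol := pow_le_volume_real_ball i₀.pos (0 : Eucl d) (half_pos one_pos)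
  rw [mul_div_cancel₀ (1 : ℝ) two_ne_zero] at hvol
  refine le_trans ?_ hpack
  gcongr
  norm_num

theorem gibbs_needle_real_compl_slopeCone_le (w : ℕ → Fin B) (hK : 8 * d ≤ K) (hi : i₀ ≠ i₁) :
    (gibbs (needle w K i₀ i₁)).real (slopeCone w d i₀ i₁)ᶜ
      ≤ Real.exp (2 * d + 4) * ((128 * (d + 1) * 2 ^ d * B ^ d) ^ 2 * (16 * d ^ 2) ^ d) / K := by
  have hK₀ := cast_pos_of_le hK i₀
  have hd : (0 : ℝ) < d := by exact_mod_cast i₀.pos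
  rw [gibbs_real_apply _ (measurableSet_slopeCone w d i₀ i₁).compl]
  calc (∫ x in (slopeCone w d i₀ i₁)ᶜ, Real.exp (-needle w K i₀ i₁ x)) /
        ∫ x, Real.exp (-needle w K i₀ i₁ x)
      ≤ Real.exp (2 * d) * ((128 * (d + 1) * 2 ^ d * B ^ d) ^ 2 * (16 * d) ^ d) /
        (K * (1 / d) ^ d * Real.exp (-4)) :=
        div_le_div₀ (by positivity) (setIntegral_compl_slopeCone_le w K hi) (by positivity)
          (natCast_le_integral_exp_neg_needle w hK hi)
    _ = Real.exp (2 * d + 4) * ((128 * (d + 1) * 2 ^ d * B ^ d) ^ 2 * (16 * d ^ 2) ^ d) / K := by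
        rw [Real.exp_add, Real.exp_neg, sq (d : ℝ), ← mul_assoc (16 : ℝ), mul_pow (16 * (d : ℝ)),
          one_div, inv_pow]
        field_simp

theorem needle_le_one_of_mem_ball (w : ℕ → Fin B) (hK : 8 * d ≤ K) (i₀ i₁ : Fin d) {x : Eucl d}
    (hx : x ∈ Metric.ball 0 1) : needle w K i₀ i₁ x ≤ 1 := by
  have hcoord (i : Fin d) : |x i| ≤ 1 :=
    (PiLp.norm_apply_le x i).trans (mem_ball_zero_iff.1 hx).le
  have hchain := wedgeChain_le_of_abs_le_one (w := w) (a := 1 / (16 * ((d : ℝ) + 1)))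
    (k := d + 1) (by positivity) (hcoord i₀) (hcoord i₁)
  have hscale : 1 / (16 * ((d : ℝ) + 1)) ≤ 1 / 16 :=
    one_div_le_one_div_of_le (by norm_num) (by linarith [(Nat.cast_nonneg d : (0 : ℝ) ≤ d)])
  have hℓ₁ : ∑ i, planeWeight (1 / K) i₀ i₁ i * |x i| ≤ ∑ i, planeWeight (1 / K) i₀ i₁ i :=
    Finset.sum_le_sum fun i _ => mul_le_of_le_one_right
      (planeWeight_pos (one_div_pos.2 (cast_pos_of_le hK i₀)) i₀ i₁ i).le (hcoord i)
  linarith [needle_le w hK i₀ i₁ x, sum_planeWeight_le (one_div_le_of_le hK i₀) i₀ i₁]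

theorem renyiInf_uniformBall_gibbs_needle_le (w : ℕ → Fin B) (hK : 8 * d ≤ K) (hi : i₀ ≠ i₁) :
    renyiInf (uniformBall d) (gibbs (needle w K i₀ i₁))
      ≤ ((2 * d + 3 + 2 * Real.log (2 * K) + d * Real.log (8 * d ^ 2) : ℝ) : EReal) := by
  have hK₀ := cast_pos_of_le hK i₀
  have hd : (0 : ℝ) < d := by exact_mod_cast i₀.pos
  have hint := integrable_exp_neg_needle w hK i₀ i₁
  refine (renyiInf_cond_gibbs_le hint measurableSet_ball
    (Metric.measure_ball_pos volume _ one_pos).ne' measure_ball_lt_top.ne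
    fun x => needle_le_one_of_mem_ball w hK i₀ i₁).trans (EReal.coe_le_coe_iff.2 ?_)
  have hZ := Real.log_le_log (integral_exp_pos hint) (integral_exp_neg_needle_le w hK hi)
  rw [Real.log_mul (by positivity) (by positivity), Real.log_exp,
    Real.log_mul (by positivity) (by positivity), Real.log_pow, Real.log_pow] at hZ
  have hvol := Real.log_le_log (by positivity)
    (pow_le_volume_real_ball i₀.pos (0 : Eucl d) one_pos)
  rw [Real.log_pow] at hvol
  have hsplit : Real.log (8 * d ^ 2) = Real.log (16 * d) - Real.log (2 * 1 / d) := by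
    rw [← Real.log_div (by positivity) (by positivity)]
    congr 1
    field_simp
    norm_num
  rw [hsplit, mul_sub]
  push_cast at hZ
  linarith

end needle

/-! ### Adaptive algorithms learn one digit per round -/

section averaging

variable {ι κ : Type*}

theorem update_updateFinset_of_mem [DecidableEq ι] {S : Finset ι} {i : ι} (hi : i ∈ S) (w : ι → κ)
    (v : S → κ) (c : κ) : Function.update (Function.updateFinset w S v) i c =
      Function.updateFinset w S (Function.update v ⟨i, hi⟩ c) := by
  ext j
  by_cases hj : j = i
  · subst hj
    simp [Function.updateFinset, hi]
  · simp [Function.updateFinset, hj]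

variable [Fintype κ]

theorem sum_mul_card_le_of_sum_update_le [Fintype ι] [DecidableEq ι] {i : ι} {b : (ι → κ) → ℝ}
    {C : ℝ} (h : ∀ w, ∑ c, b (Function.update w i c) ≤ C) :
    (∑ w, b w) * Fintype.card κ ≤ Fintype.card (ι → κ) * C := by
  have hswap : Function.Involutive fun p : (ι → κ) × κ => (Function.update p.1 i p.2, p.1 i) :=
    fun p => by ext <;> simp
  calc (∑ w, b w) * Fintype.card κ = ∑ p : (ι → κ) × κ, b p.1 := by
        simp only [Fintype.sum_prod_type, Finset.sum_const, Finset.card_univ, nsmul_eq_mul]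
        rw [← Finset.mul_sum, mul_comm]
    _ = ∑ p : (ι → κ) × κ, b (Function.update p.1 i p.2) :=
        (Equiv.sum_comp hswap.toPerm fun p => b p.1).symm
    _ ≤ ∑ _w : ι → κ, C := by
        rw [Fintype.sum_prod_type]
        exact Finset.sum_le_sum fun w _ => h w
    _ = Fintype.card (ι → κ) * C := by rw [Finset.sum_const, nsmul_eq_mul, Finset.card_univ]

theorem exists_sum_le_of_sum_update_le [DecidableEq ι] [Nonempty κ] (S : Finset ι)
    {b : ι → (ι → κ) → ℝ} {C : ℝ} (h : ∀ i ∈ S, ∀ w, ∑ c, b i (Function.update w i c) ≤ C) :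
    ∃ w, ∑ i ∈ S, b i w ≤ S.card * C / Fintype.card κ := by
  have hκ : (0 : ℝ) < Fintype.card κ := by exact_mod_cast Fintype.card_pos
  obtain ⟨w₀⟩ : Nonempty (ι → κ) := inferInstance
  have hmean : ∀ i ∈ S, ∑ v : S → κ, b i (Function.updateFinset w₀ S v)
      ≤ ∑ _v : S → κ, C / Fintype.card κ := fun i hi => by
    rw [Finset.sum_const, nsmul_eq_mul, Finset.card_univ, ← mul_div_assoc, le_div_iff₀ hκ]
    refine sum_mul_card_le_of_sum_update_le (i := ⟨i, hi⟩) fun v => ?_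
    simpa only [update_updateFinset_of_mem hi] using h i hi (Function.updateFinset w₀ S v)
  have hsum : ∑ v : S → κ, ∑ i ∈ S, b i (Function.updateFinset w₀ S v)
      ≤ ∑ _v : S → κ, S.card * C / Fintype.card κ := by
    rw [Finset.sum_comm]
    refine (Finset.sum_le_sum hmean).trans_eq ?_
    simp only [Finset.sum_const, nsmul_eq_mul]
    ring
  obtain ⟨v, -, hv⟩ := Finset.exists_le_of_sum_le Finset.univ_nonempty hsum
  exact ⟨_, hv⟩

open scoped Classical in
theorem sum_measureReal_le_of_card_le {Ω : Type*} [MeasurableSpace Ω] (μ : Measure Ω)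
    [IsProbabilityMeasure μ] {E : κ → Set Ω} (hE : ∀ c, MeasurableSet (E c)) {n : ℕ}
    (h : ∀ ω, (Finset.univ.filter fun c => ω ∈ E c).card ≤ n) : ∑ c, μ.real (E c) ≤ n := by
  have hint (c : κ) : Integrable ((E c).indicator (1 : Ω → ℝ)) μ :=
    (integrable_indicator_iff (hE c)).2 (integrable_const 1).integrableOn
  calc ∑ c, μ.real (E c) = ∫ ω, ∑ c, (E c).indicator 1 ω ∂μ := by
        rw [integral_finsetSum _ fun c _ => hint c]
        exact Finset.sum_congr rfl fun c _ => (integral_indicator_one (hE c)).symm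
    _ ≤ ∫ _, (n : ℝ) ∂μ := by
        refine integral_mono (integrable_finsetSum _ fun c _ => hint c) (integrable_const _)
          fun ω => ?_
        simp only [Set.indicator_apply, Pi.one_apply, Finset.sum_boole]
        exact_mod_cast h ω
    _ = n := by simp

end averaging

namespace AdaptiveAlgorithm

variable {d k : ℕ} (A : AdaptiveAlgorithm d k) {f : Eucl d → ℝ}

theorem transcript_succ_congr {f' : Eucl d → ℝ} {r i : ℕ} {x₀ : Eucl d} {ξ : ℕ → unitInterval}
    (h : A.transcript f r x₀ ξ i = A.transcript f' r x₀ ξ i)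
    (hQ : ∀ l, f (A.next r i (ξ i, A.transcript f r x₀ ξ i) l) =
      f' (A.next r i (ξ i, A.transcript f r x₀ ξ i) l)) :
    A.transcript f r x₀ ξ (i + 1) = A.transcript f' r x₀ ξ (i + 1) := by
  simp only [transcript, ← h, hQ]

theorem measurable_transcript (hf : Measurable f) (r n : ℕ) :
    Measurable fun ω : Eucl d × (ℕ → unitInterval) => A.transcript f r ω.1 ω.2 n := by
  induction n with
  | zero => exact (measurable_fst.prodMk (hf.comp measurable_fst)).prodMk measurable_const
  | succ n ih =>
    have hQ : Measurable fun ω : Eucl d × (ℕ → unitInterval) =>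
        A.next r n (ω.2 n, A.transcript f r ω.1 ω.2 n) :=
      (A.measurable_next r n).comp (((measurable_pi_apply n).comp measurable_snd).prodMk ih)
    refine (measurable_fst.comp ih).prodMk (measurable_pi_iff.2 fun i => ?_)
    refine Fin.lastCases ?_ (fun i => ?_) i
    · simp only [Fin.snoc_last]
      exact measurable_pi_iff.2 fun l => (measurable_pi_iff.1 hQ l).prodMk
        (hf.comp (measurable_pi_iff.1 hQ l))
    · simp only [Fin.snoc_castSucc]
      exact (measurable_pi_apply i).comp (measurable_snd.comp ih)

theorem measurable_next_transcript (hf : Measurable f) (r i : ℕ) :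
    Measurable fun ω : Eucl d × (ℕ → unitInterval) =>
      A.next r i (ω.2 i, A.transcript f r ω.1 ω.2 i) :=
  (A.measurable_next r i).comp
    (((measurable_pi_apply i).comp measurable_snd).prodMk (A.measurable_transcript hf r i))

theorem measurable_run (hf : Measurable f) (r : ℕ) :
    Measurable fun ω : Eucl d × (ℕ → unitInterval) => A.run f r ω.1 ω.2 :=
  (A.measurable_output r).comp
    (((measurable_pi_apply r).comp measurable_snd).prodMk (A.measurable_transcript hf r r))

/-- The points at which the algorithm can touch the hidden set at stage `i` of a run: the initial
point at stage `0`, and the queries of round `i` as well as the output at a later stage `i`. -/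
def probe (f : Eucl d → ℝ) (r : ℕ) (ω : Eucl d × (ℕ → unitInterval)) :
    ℕ → Option (Fin k) → Eucl d
  | 0, _ => ω.1
  | _ + 1, none => A.run f r ω.1 ω.2
  | i + 1, some l => A.next r i (ω.2 i, A.transcript f r ω.1 ω.2 i) l

theorem measurable_probe (hf : Measurable f) (r i : ℕ) (l : Option (Fin k)) :
    Measurable fun ω => A.probe f r ω i l := by
  match i, l with
  | 0, _ => exact measurable_fst
  | _ + 1, none => exact A.measurable_run hf r
  | i + 1, some l => exact measurable_pi_iff.1 (A.measurable_next_transcript hf r i) l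

end AdaptiveAlgorithm

section digits

variable {κ : Type*} {w : ℕ → κ} {d k : ℕ}

open scoped Classical in
/-- The potentials `F w` hide the digits `w` in the decreasing sets `C w 0, C w 1, …`: outside of
`C w j` the potential depends on the first `j` digits only, and if all digits but `w j` are known,
then a point lies in `C w (j + 1)` for at most `n` values of `w j`. -/
structure HidesDigits [Fintype κ] (F : (ℕ → κ) → Eucl d → ℝ)
    (C : (ℕ → κ) → ℕ → Set (Eucl d)) (n : ℕ) : Prop where
  measurable : ∀ w, Measurable (F w)
  measurableSet : ∀ w j, MeasurableSet (C w j)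
  antitone : ∀ w, Antitone (C w)
  congr : ∀ {w w' j x}, (∀ i < j, w i = w' i) → x ∉ C w j → F w x = F w' x
  card_le : ∀ w j x,
    (Finset.univ.filter fun c => x ∈ C (Function.update w j c) (j + 1)).card ≤ n

variable [Inhabited κ]

/-- The first `j` digits of `w`, followed by a constant sequence. -/
def truncateDigits (j : ℕ) (w : ℕ → κ) (i : ℕ) : κ := if i < j then w i else default

theorem truncateDigits_apply_of_lt {i j : ℕ} (h : i < j) : truncateDigits j w i = w i := if_pos h

theorem truncateDigits_update (j : ℕ) (w : ℕ → κ) (c : κ) :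
    truncateDigits j (Function.update w j c) = truncateDigits j w :=
  funext fun _ => if_ctx_congr Iff.rfl (fun h => Function.update_of_ne h.ne _ _) fun _ => rfl

/-- The event that at stage `i` of the run on the potential with erased digits `w i, w (i + 1), …`,
the algorithm guesses the digit `w i`. -/
def guessEvent (A : AdaptiveAlgorithm d k) (F : (ℕ → κ) → Eucl d → ℝ)
    (C : (ℕ → κ) → ℕ → Set (Eucl d)) (w : ℕ → κ) (r i : ℕ) : Set (Eucl d × (ℕ → unitInterval)) :=
  {ω | ∃ l, A.probe (F (truncateDigits i w)) r ω i l ∈ C w (i + 1)}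

namespace HidesDigits

variable [Fintype κ] {F : (ℕ → κ) → Eucl d → ℝ} {C : (ℕ → κ) → ℕ → Set (Eucl d)} {n r : ℕ}

theorem sum_guessEvent_update_le (h : HidesDigits F C n) (A : AdaptiveAlgorithm d k)
    (μ : Measure (Eucl d × (ℕ → unitInterval))) [IsProbabilityMeasure μ] (w : ℕ → κ) (r i : ℕ) :
    ∑ c, μ.real (guessEvent A F C (Function.update w i c) r i) ≤ ((k + 1) * n : ℕ) := by
  classical
  simp only [guessEvent, truncateDigits_update]
  refine sum_measureReal_le_of_card_le μ (fun c => ?_) fun ω => ?_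
  · rw [Set.ofPred_exists]
    exact MeasurableSet.iUnion fun l =>
      A.measurable_probe (h.measurable _) r i l (h.measurableSet _ _)
  · have hunion : (Finset.univ.filter fun c => ∃ l,
          A.probe (F (truncateDigits i w)) r ω i l ∈ C (Function.update w i c) (i + 1)) =
        Finset.univ.biUnion fun l => Finset.univ.filter fun c =>
          A.probe (F (truncateDigits i w)) r ω i l ∈ C (Function.update w i c) (i + 1) := by
      ext
      simp
    simp only [Set.mem_ofPred_eq]
    calc (Finset.univ.filter fun c => ∃ l,
          A.probe (F (truncateDigits i w)) r ω i l ∈ C (Function.update w i c) (i + 1)).card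
        ≤ Fintype.card (Option (Fin k)) * n := by
          rw [hunion]
          exact Finset.card_biUnion_le_card_mul _ _ n fun l _ => h.card_le w i _
      _ = (k + 1) * n := by rw [Fintype.card_option, Fintype.card_fin]

theorem transcript_congr (h : HidesDigits F C n) (A : AdaptiveAlgorithm d k)
    {ω : Eucl d × (ℕ → unitInterval)} (hω : ∀ i ≤ r, ω ∉ guessEvent A F C w r i) {i : ℕ}
    (hi : i ≤ r) {w' : ℕ → κ} (hw : ∀ j < i + 1, w j = w' j) :
    A.transcript (F w) r ω.1 ω.2 i = A.transcript (F w') r ω.1 ω.2 i := by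
  induction i generalizing w' with
  | zero =>
    have hx₀ : ω.1 ∉ C w 1 := fun hmem => hω 0 hi ⟨none, hmem⟩
    simp only [AdaptiveAlgorithm.transcript, h.congr hw hx₀]
  | succ i ih =>
    have hself := ih (by omega) fun j hj => hw j (by omega)
    have htrunc := ih (by omega) fun j hj => (truncateDigits_apply_of_lt (w := w) hj).symm
    refine A.transcript_succ_congr hself fun l => h.congr hw fun hmem => hω (i + 1) hi ⟨some l, ?_⟩
    rwa [htrunc] at hmem

theorem run_notMem (h : HidesDigits F C n) (A : AdaptiveAlgorithm d k)
    {ω : Eucl d × (ℕ → unitInterval)} (hω : ∀ i ≤ r + 1, ω ∉ guessEvent A F C w r i) :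
    A.run (F w) r ω.1 ω.2 ∉ C w (r + 2) := fun hmem => by
  refine hω (r + 1) le_rfl ⟨none, ?_⟩
  rwa [AdaptiveAlgorithm.run, h.transcript_congr A (fun i hi => hω i (by omega)) le_rfl
    fun j hj => (truncateDigits_apply_of_lt (w := w) hj).symm] at hmem

theorem exists_outputLaw_real_le (h : HidesDigits F C n) (A : AdaptiveAlgorithm d k)
    (ρ₀ : Measure (Eucl d)) [IsProbabilityMeasure ρ₀] (N : ℕ) :
    ∃ w, ∀ r, r + 2 ≤ N →
      (A.outputLaw (F w) ρ₀ r).real (C w N) ≤ N * (N * ((k + 1) * n)) / Fintype.card κ := by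
  set μ : Measure (Eucl d × (ℕ → unitInterval)) :=
    ρ₀.prod (Measure.infinitePi fun _ : ℕ => (volume : Measure unitInterval)) with hμ
  have hguess (i : ℕ) (w : ℕ → κ) : ∑ c, ∑ r ∈ Finset.range N,
      μ.real (guessEvent A F C (Function.update w i c) r i) ≤ N * ((k + 1) * n) := by
    rw [Finset.sum_comm]
    refine (Finset.sum_le_sum fun r _ => h.sum_guessEvent_update_le A μ w r i).trans_eq ?_
    simp
  obtain ⟨w, hw⟩ := exists_sum_le_of_sum_update_le (Finset.range N)
    (b := fun i w => ∑ r ∈ Finset.range N, μ.real (guessEvent A F C w r i)) fun i _ => hguess i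
  rw [Finset.card_range] at hw
  refine ⟨w, fun r hr => le_trans ?_ hw⟩
  have hsub : (fun ω : Eucl d × (ℕ → unitInterval) => A.run (F w) r ω.1 ω.2) ⁻¹' C w N ⊆
      ⋃ i ∈ Finset.range N, guessEvent A F C w r i := fun ω hω => by
    by_contra hno
    simp only [Set.mem_iUnion, Finset.mem_range, not_exists] at hno
    exact h.run_notMem A (fun i hi => hno i (by omega)) (h.antitone w hr hω)
  rw [AdaptiveAlgorithm.outputLaw, map_measureReal_apply (A.measurable_run (h.measurable w) r)
    (h.measurableSet w N), ← hμ]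
  calc μ.real _ ≤ μ.real (⋃ i ∈ Finset.range N, guessEvent A F C w r i) :=
        measureReal_mono hsub (measure_ne_top μ _)
    _ ≤ ∑ i ∈ Finset.range N, μ.real (guessEvent A F C w r i) :=
        measureReal_biUnion_finset_le _ _
    _ ≤ ∑ i ∈ Finset.range N, ∑ r ∈ Finset.range N, μ.real (guessEvent A F C w r i) :=
        Finset.sum_le_sum fun i _ => Finset.single_le_sum
          (f := fun r => μ.real (guessEvent A F C w r i)) (fun _ _ => measureReal_nonneg)
          (Finset.mem_range.2 (by omega))

theorem le_randomizedComplexity (h : HidesDigits F C n)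
    (hint : ∀ w, Integrable fun x => Real.exp (-F w x)) {N : ℕ} {δ ε : ℝ}
    (hδ : ∀ w, (gibbs (F w)).real (C w N)ᶜ ≤ δ)
    (hε : ε < 1 - δ - N * (N * ((k + 1) * n)) / Fintype.card κ)
    (ρ₀ : Measure (Eucl d)) [IsProbabilityMeasure ρ₀] {𝓕 : Set (Eucl d → ℝ)}
    (hF : ∀ w, F w ∈ 𝓕) : ((N - 1 : ℕ) : ℕ∞) ≤ randomizedComplexity k 𝓕 ε ρ₀ := by
  refine le_iInf fun A => ?_
  obtain ⟨w, hw⟩ := h.exists_outputLaw_real_le A ρ₀ N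
  refine le_trans (le_iInf₂ fun r hr => ?_) (le_iSup₂ (f := fun f _ => A.rounds f ρ₀ ε) _ (hF w))
  by_contra! hlt
  have hrN : r < N - 1 := by exact_mod_cast hlt
  have hlaw := hw r (by omega)
  have : IsProbabilityMeasure (A.outputLaw (F w) ρ₀ r) :=
    Measure.isProbabilityMeasure_map (A.measurable_run (h.measurable w) r).aemeasurable
  have : IsProbabilityMeasure (gibbs (F w)) := isProbabilityMeasure_tilted (hint w)
  have htv : tvDist (A.outputLaw (F w) ρ₀ r) (gibbs (F w)) ≤ ε := hr
  have hgibbs := hδ w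
  rw [probReal_compl_eq_one_sub (h.measurableSet w N)] at hgibbs
  linarith [measureReal_sub_le_tvDist (A.outputLaw (F w) ρ₀ r) (gibbs (F w))
    (h.measurableSet w N)]

end HidesDigits

end digits

/-! ### The lower bound -/

section parameters

variable {B d k K : ℕ}

theorem hidesDigits_needle (hK : 8 * d ≤ K) (i₀ i₁ : Fin d) :
    HidesDigits (fun w : ℕ → Fin B => needle w K i₀ i₁) (fun w j => slopeCone w j i₀ i₁) 10 where
  measurable w := (smoothConvex_needle w hK i₀ i₁).diff.continuous.measurable
  measurableSet w j := measurableSet_slopeCone w j i₀ i₁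
  antitone _ _ _ hij _ hx := InCone.anti hij hx
  congr hw hx := needle_congr hw hx
  card_le w j x := card_filter_inCone_update_le w j (x i₀) (x i₁)

theorem mul_sq_natCast_le (hd : 16 ≤ d) (hB : d ^ 4 ≤ B) : 256 * (d : ℝ) ^ 2 ≤ B := by
  have hd' : (16 : ℝ) ≤ d := by exact_mod_cast hd
  calc 256 * (d : ℝ) ^ 2 = 16 ^ 2 * (d : ℝ) ^ 2 := by norm_num
    _ ≤ (d : ℝ) ^ 2 * (d : ℝ) ^ 2 := by gcongr
    _ = (d : ℝ) ^ 4 := by ring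
    _ ≤ B := by exact_mod_cast hB

theorem exp_two_mul_add_four_le_pow {b : ℝ} (hd : 2 ≤ d) (hb : 81 ≤ b) :
    Real.exp (2 * d + 4) ≤ b ^ d := by
  have hd' : (2 : ℝ) ≤ d := by exact_mod_cast hd
  calc Real.exp (2 * d + 4) ≤ Real.exp ((4 * d : ℕ) * 1) :=
        Real.exp_le_exp.2 (by push_cast; linarith)
    _ = (Real.exp 1 ^ 4) ^ d := by rw [Real.exp_nat_mul, pow_mul]
    _ ≤ (3 ^ 4) ^ d := by
        gcongr
        exact Real.exp_one_lt_three.le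
    _ ≤ b ^ d := by
        gcongr
        linarith

theorem needle_mass_bound_le (hd : 16 ≤ d) (hB : d ^ 4 ≤ B) :
    Real.exp (2 * d + 4) * ((128 * (d + 1) * 2 ^ d * B ^ d) ^ 2 * (16 * d ^ 2) ^ d) /
      (B ^ (7 * d) : ℕ) ≤ 1 / (d : ℝ) := by
  have hd' : (16 : ℝ) ≤ d := by exact_mod_cast hd
  have hdB := mul_sq_natCast_le hd hB
  push_cast
  set b := (B : ℝ)
  have hb : 65536 ≤ b := by nlinarith
  have hexp : Real.exp (2 * d + 4) ≤ b ^ d := exp_two_mul_add_four_le_pow (by omega) (by linarith)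
  have hscale : (128 * ((d : ℝ) + 1)) ^ 2 ≤ b ^ d :=
    calc (128 * ((d : ℝ) + 1)) ^ 2 ≤ b ^ 2 := by
          gcongr
          nlinarith
      _ ≤ b ^ d := pow_le_pow_right₀ (by linarith) (by omega)
  have hfour : (4 : ℝ) ^ d ≤ b ^ d := by
    gcongr
    linarith
  have hsq : (16 * (d : ℝ) ^ 2) ^ d ≤ b ^ d := by
    gcongr
    nlinarith
  have hself : (d : ℝ) ≤ b ^ d :=
    le_trans (by nlinarith) (le_self_pow₀ (by linarith : 1 ≤ b) (by omega))
  rw [div_le_div_iff₀ (by positivity) (by positivity), one_mul]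
  calc Real.exp (2 * d + 4) * ((128 * (d + 1) * 2 ^ d * b ^ d) ^ 2 * (16 * d ^ 2) ^ d) * d
      = Real.exp (2 * d + 4) * (128 * ((d : ℝ) + 1)) ^ 2 * 4 ^ d * (16 * (d : ℝ) ^ 2) ^ d * d *
          (b ^ d) ^ 2 := by
        rw [show (4 : ℝ) = 2 ^ 2 by norm_num, ← pow_mul, mul_comm 2 d, pow_mul]
        ring
    _ ≤ b ^ d * b ^ d * b ^ d * b ^ d * b ^ d * (b ^ d) ^ 2 := by gcongr
    _ = b ^ (7 * d) := by
        rw [mul_comm 7 d, pow_mul]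
        ring

theorem needle_warm_bound_le (hd : 16 ≤ d) (hB : d ^ 4 ≤ B) :
    2 * d + 3 + 2 * Real.log (2 * (B ^ (7 * d) : ℕ)) + d * Real.log (8 * d ^ 2)
      ≤ 18 * d * Real.log B := by
  have hd' : (16 : ℝ) ≤ d := by exact_mod_cast hd
  have hdB := mul_sq_natCast_le hd hB
  have hB₀ : (0 : ℝ) < B := by nlinarith
  have hlog : 1 ≤ Real.log B :=
    (Real.le_log_iff_exp_le hB₀).2 (Real.exp_one_lt_three.le.trans (by nlinarith))
  have hsq : Real.log (8 * d ^ 2) ≤ Real.log B :=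
    Real.log_le_log (by positivity) (le_trans (by nlinarith) hdB)
  push_cast
  rw [Real.log_mul two_ne_zero (by positivity), Real.log_pow]
  push_cast
  nlinarith [Real.log_two_lt_d9]

theorem needle_mem_warmPotentials (reg : Regularity) (hd : 16 ≤ d) (hB : d ^ 4 ≤ B) {M : ℝ}
    (hM : 18 * d * Real.log B ≤ M) (w : ℕ → Fin B) (hK : 8 * d ≤ B ^ (7 * d)) {i₀ i₁ : Fin d}
    (hi : i₀ ≠ i₁) :
    needle w (B ^ (7 * d)) i₀ i₁ ∈ warmPotentials reg d (uniformBall d) M :=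
  ⟨(smoothConvex_needle w hK i₀ i₁).mem_convexPotentials reg,
    integrable_exp_neg_needle w hK i₀ i₁, (renyiInf_uniformBall_gibbs_needle_le w hK hi).trans
      (EReal.coe_le_coe_iff.2 ((needle_warm_bound_le hd hB).trans hM))⟩

theorem le_randomizedComplexity_warmPotentials (reg : Regularity) (hd : 16 ≤ d) (hB : d ^ 4 ≤ B)
    (hk : 10 * (k + 1) * d ^ 3 ≤ B) {M ε : ℝ} (hM : 18 * d * Real.log B ≤ M)
    (hε : ε < 1 - 2 / d) : ((d - 1 : ℕ) : ℕ∞) ≤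
      randomizedComplexity k (warmPotentials reg d (uniformBall d) M) ε (uniformBall d) := by
  have hd₀ : (0 : ℝ) < d := by exact_mod_cast (by omega : 0 < d)
  have hB₀ : 0 < B := lt_of_lt_of_le (by positivity) hB
  have : NeZero B := ⟨hB₀.ne'⟩
  have hK : 8 * d ≤ B ^ (7 * d) :=
    calc 8 * d ≤ d ^ 3 * d := by
          gcongr
          exact le_trans (by omega) (Nat.le_self_pow three_ne_zero d)
      _ = d ^ 4 := by ring
      _ ≤ B := hB
      _ ≤ B ^ (7 * d) := Nat.le_self_pow (by omega) B
  have hi : (⟨0, by omega⟩ : Fin d) ≠ ⟨1, by omega⟩ := by simp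
  have hguess : (d : ℝ) * (d * ((k + 1) * (10 : ℕ))) / Fintype.card (Fin B) ≤ 1 / d := by
    rw [Fintype.card_fin, div_le_div_iff₀ (by exact_mod_cast hB₀) hd₀, one_mul]
    calc (d : ℝ) * (d * ((k + 1) * (10 : ℕ))) * d = (10 * (k + 1) * d ^ 3 : ℕ) := by
          push_cast
          ring
      _ ≤ B := by exact_mod_cast hk
  refine (hidesDigits_needle hK _ _).le_randomizedComplexity (δ := 1 / d)
    (fun w => integrable_exp_neg_needle w hK _ _) (fun w => ?_) ?_ (uniformBall d)
    fun w => needle_mem_warmPotentials reg hd hB hM w hK hi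
  · exact (gibbs_needle_real_compl_slopeCone_le w hK hi).trans (needle_mass_bound_le hd hB)
  · rw [show (2 : ℝ) / d = 1 / d + 1 / d by ring] at hε
    linarith

end parameters

theorem eval_le_eval_one_mul_pow (q : Polynomial ℕ) {d : ℕ} (hd : 1 ≤ d) :
    q.eval d ≤ q.eval 1 * d ^ q.natDegree := by
  simp only [Polynomial.eval_eq_sum_range, one_pow, mul_one, Finset.sum_mul]
  exact Finset.sum_le_sum fun i hi => Nat.mul_le_mul_left _
    (Nat.pow_le_pow_right hd (Finset.mem_range_succ_iff.1 hi))

theorem eventually_eval_le_pow_log (q : Polynomial ℕ) :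
    ∀ᶠ d : ℕ in atTop, q.eval d ≤ d ^ Nat.log 2 d := by
  filter_upwards [eventually_ge_atTop (q.eval 1), eventually_ge_atTop (2 ^ (q.natDegree + 1))]
    with d hcoeff hdeg
  have hd : 1 ≤ d := Nat.one_le_two_pow.trans hdeg
  calc q.eval d ≤ q.eval 1 * d ^ q.natDegree := eval_le_eval_one_mul_pow q hd
    _ ≤ d * d ^ q.natDegree := by gcongr
    _ = d ^ (q.natDegree + 1) := (pow_succ' d _).symm
    _ ≤ d ^ Nat.log 2 d := Nat.pow_le_pow_right hd (Nat.le_log_of_pow_le one_lt_two hdeg)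

theorem log_pow_natLog_le (d : ℕ) :
    Real.log ((d ^ Nat.log 2 d : ℕ) : ℝ) ≤ 2 * Real.log d ^ 2 := by
  have hlog : 0 ≤ Real.log d := Real.log_natCast_nonneg d
  have hnatLog : (Nat.log 2 d : ℝ) * Real.log 2 ≤ Real.log d := by
    rw [← le_div_iff₀ (Real.log_pos one_lt_two)]
    exact Real.natLog_le_logb d 2
  have htwo : (Nat.log 2 d : ℝ) ≤ 2 * Real.log d := by
    nlinarith [Real.log_two_gt_d9, (Nat.log 2 d).cast_nonneg (α := ℝ)]
  rw [Nat.cast_pow, Real.log_pow]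
  nlinarith

theorem eventually_ofReal_div_mul_log_le {α : ℕ → ℝ} (hα : Tendsto α atTop atTop) :
    ∀ᶠ d : ℕ in atTop,
      ENNReal.ofReal (d / (α d * Real.log d ^ 3)) ≤ (((d - 1 : ℕ) : ℕ∞) : ℝ≥0∞) := by
  filter_upwards [hα.eventually_ge_atTop 2, eventually_ge_atTop 3] with d hαd hd
  have hd' : (3 : ℝ) ≤ d := by exact_mod_cast hd
  have hlog : 1 ≤ Real.log d := (Real.le_log_iff_exp_le (by positivity)).2
    (Real.exp_one_lt_three.le.trans hd')
  have hden : 2 ≤ α d * Real.log d ^ 3 := by nlinarith [one_le_pow₀ hlog (n := 3)]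
  calc ENNReal.ofReal (d / (α d * Real.log d ^ 3)) ≤ ENNReal.ofReal ((d - 1 : ℕ) : ℝ) := by
        rw [Nat.cast_pred (by omega)]
        exact ENNReal.ofReal_le_ofReal ((div_le_div_of_nonneg_left (by positivity) two_pos
          hden).trans (by linarith))
    _ = (((d - 1 : ℕ) : ℕ∞) : ℝ≥0∞) := by simp

theorem mainTheorem2_general (reg : Regularity) (q : Polynomial ℕ) :
    ∀ᶠ d : ℕ in atTop, ∀ ε < 1 - 2 / (d : ℝ), ((d - 1 : ℕ) : ℕ∞) ≤
      randomizedComplexity (q.eval d)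
        (warmPotentials reg d (uniformBall d) (36 * d * Real.log d ^ 2)) ε (uniformBall d) := by
  filter_upwards [eventually_eval_le_pow_log (10 * (q + 1) * Polynomial.X ^ 3),
    eventually_ge_atTop 16] with d hq hd ε hε
  have hfour : 4 ≤ Nat.log 2 d := Nat.le_log_of_pow_le one_lt_two hd
  refine le_randomizedComplexity_warmPotentials reg hd (Nat.pow_le_pow_right (by omega) hfour)
    (by simpa using hq) ?_ hε
  calc 18 * d * Real.log (d ^ Nat.log 2 d : ℕ) ≤ 18 * d * (2 * Real.log d ^ 2) := by
        gcongr
        exact log_pow_natLog_le d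
    _ = 36 * d * Real.log d ^ 2 := by ring

end

theorem mainTheorem2 (reg : Regularity) :
    ∃ c : ℝ, 0 < c ∧ c < 1 ∧ ∃ (C : ℝ) (m : ℕ),
      ∀ α ε : ℕ → ℝ, Tendsto α atTop atTop → ε =O[atTop] (fun d : ℕ => c ^ d) →
        ∃ (γ : ℕ → ℝ) (ρ₀ : (d : ℕ) → Measure (Eucl d)),
          γ =O[atTop] (fun d : ℕ => (d : ℝ) ^ (-α d)) ∧
          (∀ d, IsProbabilityMeasure (ρ₀ d)) ∧
          ∀ q : Polynomial ℕ, ∀ᶠ d : ℕ in atTop,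
            ENNReal.ofReal ((1 - γ d) * (d / (α d * Real.log d ^ 3))) ≤
              ((randomizedComplexity (q.eval d)
                (warmPotentials reg d (ρ₀ d) (C * d * Real.log d ^ m)) (ε d) (ρ₀ d) : ℕ∞) : ℝ≥0∞)
    := by
  refine ⟨1 / 2, by norm_num, by norm_num, 36, 2, fun α ε hα hε => ⟨fun _ => 0, uniformBall,
    isBigO_zero _ _, fun d => inferInstance, fun q => ?_⟩⟩
  have hε₀ : Tendsto ε atTop (nhds 0) :=
    hε.trans_tendsto (tendsto_pow_atTop_nhds_zero_of_lt_one (by norm_num) (by norm_num))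
  have hthreshold : Tendsto (fun d : ℕ => 1 - 2 / (d : ℝ)) atTop (nhds 1) := by
    simpa using (tendsto_const_div_atTop_nhds_zero_nat (2 : ℝ)).const_sub 1
  filter_upwards [mainTheorem2_general reg q, eventually_ofReal_div_mul_log_le hα,
    hε₀.eventually_lt hthreshold one_pos] with d hcomplexity hrate hεd
  rw [sub_zero, one_mul]
  exact hrate.trans (ENat.toENNReal_mono (hcomplexity _ hεd))
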